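/- Conventions. Equip $\mathbb{R}^4$ with its standard inner product; a "circle" means a round circle or a straight line. A \emph{simple bundle of circles} is a set $\mathcal S$ of circles through $0$ no two of which are tangent to each other at $0$. It is \emph{rectifiable} if there is a germ at $0$ of a ($C^\infty$) diffeomorphism of $\mathbb{R}^4$ sending the germ at $0$ of each circle of $\mathcal S$ to the germ of a straight line. A \emph{quaternionic structure} is a triple $(I,J,K)$ of linear operators on $\mathbb{R}^4$ preserving the inner product with $I^2=J^2=K^2=-1$, $IJ=-JI=K$, $JK=-KJ=I$, $KI=-IK=J$. Together with a unit vector $e$ it identifies $\mathbb{H}$ with $\mathbb{R}^4$ by $a_0+a_1i+a_2j+a_3k\mapsto a_0e+a_1Ie+a_2Je+a_3Ke$; products and inverses of vectors below are taken in the sense of this identification (so $1=e$). For a linear operator $A:\mathbb{R}^4\to\mathbb{R}^4$ let $$L_A:\ x\mapsto (1-A(x))^{-1}x,\qquad R_A:\ x\mapsto x(1-A(x))^{-1},$$ both defined on $\{x : A(x)\neq 1\}$. \textbf{Theorem.} (1) There are an integer $N\ge 0$ and a nonzero real polynomial $P$ on $(\mathbb{R}^4)^N$ such that the following holds. Let $\mathcal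 S$ be a rectifiable simple bundle of circles in $\mathbb{R}^4$ containing sufficiently many circles in general position, in the sense that there are circles $c_1,\dots,c_N\in\mathcal S$ with nonzero tangent vectors $v_1,\dots,v_N$ at $0$ such that $P(v_1,\dots,v_N)\ne 0$. Then for every quaternionic structure (and every unit vector $e$) there is a linear operator $A:\mathbb{R}^4\to\mathbb{R}^4$ such that $\mathcal S$ is obtained from the family of the tangent lines at $0$ of its circles either by $T=L_A$ or by $T=R_A$: for every $c\in\mathcal S$ with tangent line $\ell$ at $0$, $T$ takes the germ of $\ell$ at $0$ onto the germ of $c$ at $0$, and $c$ is the closure of the image under $T$ of the part of $\ell$ where $T$ is defined. (2) The answer does not depend on the choice of the quaternionic structure (and of $e$): given two choices, denote by $\mathcal L,\mathcal L'$ the sets of all transformations $L_A$, and by $\mathcal R,\mathcal R'$ the sets of all transformations $R_A$, where $A$ ranges over all linear operators, formed with the first and with the second choice respectively. Then either $\mathcal L=\mathcal L'$ and $\mathcal R=\mathcal R'$, or $\mathcal L=\mathcal R'$ and $\mathcal R=\mathcal L'$. -/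

import Mathlib

open Filter Topology
open scoped Quaternion ContDiff RealInnerProductSpace

/-- Euclidean four-space. -/
abbrev E4 : Type := EuclideanSpace ℝ (Fin 4)

/-! ### Lines, circles, bundles of circles -/

/-- Straight lines in Euclidean four-space. -/
def IsStraightLine (c : Set E4) : Prop :=
  ∃ P : AffineSubspace ℝ E4, Module.finrank ℝ P.direction = 1 ∧ c = (P : Set E4)

/-- Round circles: spheres of positive radius inside an affine plane, centred in that plane. -/
def IsRoundCircle (c : Set E4) : Prop :=
  ∃ (P : AffineSubspace ℝ E4) (o : E4) (r : ℝ),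
    Module.finrank ℝ P.direction = 2 ∧ o ∈ P ∧ 0 < r ∧ c = {x | x ∈ P ∧ dist x o = r}

/-- The word "circle" means a round circle or a straight line. -/
def IsCircle (c : Set E4) : Prop := IsRoundCircle c ∨ IsStraightLine c

/-- The tangent line at the origin of a circle through the origin. -/
def tangentLine (c : Set E4) : Set E4 := tangentConeAt ℝ c 0

/-- A simple bundle of circles: a family of circles through the origin, no two of which are
tangent to each other at the origin. -/
def IsSimpleBundle (S : Set (Set E4)) : Prop :=
  (∀ c ∈ S, IsCircle c ∧ (0 : E4) ∈ c) ∧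
    ∀ c₁ ∈ S, ∀ c₂ ∈ S, c₁ ≠ c₂ → tangentLine c₁ ≠ tangentLine c₂

/-- A family of curves through the origin is rectifiable if some germ at the origin of a smooth
diffeomorphism sends the germ of each of its curves to the germ of a straight line. -/
def IsRectifiable (S : Set (Set E4)) : Prop :=
  ∃ f : OpenPartialHomeomorph E4 E4,
    (0 : E4) ∈ f.source ∧ ContDiffOn ℝ ∞ f f.source ∧ ContDiffOn ℝ ∞ f.symm f.target ∧
      ∀ c ∈ S, ∃ L : Set E4, IsStraightLine L ∧ ∀ᶠ x in 𝓝 (0 : E4), (x ∈ c ↔ f x ∈ L)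

/-- `S` contains `N` circles whose tangent directions at the origin avoid the zero set of the
polynomial `P` in the coordinates of `N` vectors. -/
def ContainsGeneric (S : Set (Set E4)) {N : ℕ} (P : MvPolynomial (Fin N × Fin 4) ℝ) : Prop :=
  ∃ (c : Fin N → Set E4) (v : Fin N → E4),
    (∀ i, c i ∈ S ∧ v i ∈ tangentLine (c i) ∧ v i ≠ 0) ∧
      MvPolynomial.eval (fun p : Fin N × Fin 4 => v p.1 p.2) P ≠ 0

/-! ### Quaternionic structures -/

/-- A quaternionic structure on Euclidean four-space compatible with the inner product. -/
structure QuaternionicStructure where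
  I : E4 →ₗ[ℝ] E4
  J : E4 →ₗ[ℝ] E4
  K : E4 →ₗ[ℝ] E4
  I_sq : ∀ x, I (I x) = -x
  J_sq : ∀ x, J (J x) = -x
  K_sq : ∀ x, K (K x) = -x
  I_J : ∀ x, I (J x) = K x
  J_I : ∀ x, J (I x) = -K x
  J_K : ∀ x, J (K x) = I x
  K_J : ∀ x, K (J x) = -I x
  K_I : ∀ x, K (I x) = J x
  I_K : ∀ x, I (K x) = -J x
  inner_I : ∀ x y, ⟪I x, I y⟫ = ⟪x, y⟫
  inner_J : ∀ x y, ⟪J x, J y⟫ = ⟪x, y⟫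
  inner_K : ∀ x y, ⟪K x, K y⟫ = ⟪x, y⟫

namespace QuaternionicStructure

/-- The action of quaternions on the space given by a quaternionic structure. -/
def act (Q : QuaternionicStructure) (a : ℍ[ℝ]) (x : E4) : E4 :=
  a.re • x + a.imI • Q.I x + a.imJ • Q.J x + a.imK • Q.K x

theorem norm_act (Q : QuaternionicStructure) (a : ℍ[ℝ]) (x : E4) :
    ‖Q.act a x‖ = ‖a‖ * ‖x‖ := by
  have skew : ∀ M : E4 →ₗ[ℝ] E4, (∀ y, M (M y) = -y) → (∀ y z, ⟪M y, M z⟫ = ⟪y, z⟫) →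
      ∀ y, ⟪y, M y⟫ = 0 := by
    intro M h1 h2 y
    have h := h2 y (M y)
    rw [h1, inner_neg_right, real_inner_comm] at h
    linarith
  have hI := skew Q.I Q.I_sq Q.inner_I
  have hJ := skew Q.J Q.J_sq Q.inner_J
  have hK := skew Q.K Q.K_sq Q.inner_K
  have hIJ : ⟪Q.I x, Q.J x⟫ = 0 := by
    have h := hK (Q.I x)
    rwa [Q.K_I] at h
  have hJK : ⟪Q.J x, Q.K x⟫ = 0 := by
    have h := hI (Q.J x)
    rwa [Q.I_J] at h
  have hIK : ⟪Q.I x, Q.K x⟫ = 0 := by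
    have h := hJ (Q.I x)
    rw [Q.J_I, inner_neg_right] at h
    linarith
  have key : ‖Q.act a x‖ * ‖Q.act a x‖ = (‖a‖ * ‖x‖) * (‖a‖ * ‖x‖) := by
    have ha : ‖a‖ * ‖a‖ = a.re ^ 2 + a.imI ^ 2 + a.imJ ^ 2 + a.imK ^ 2 := by
      rw [← Quaternion.normSq_eq_norm_mul_self, Quaternion.normSq_def']
    rw [mul_mul_mul_comm, ha, ← real_inner_self_eq_norm_mul_norm,
      ← real_inner_self_eq_norm_mul_norm]
    simp only [act, inner_add_left, inner_add_right, real_inner_smul_left,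
      real_inner_smul_right, Q.inner_I, Q.inner_J, Q.inner_K, hI x, hJ x, hK x, hIJ, hJK, hIK]
    have e1 : ⟪Q.I x, x⟫ = 0 := by rw [real_inner_comm]; exact hI x
    have e2 : ⟪Q.J x, x⟫ = 0 := by rw [real_inner_comm]; exact hJ x
    have e3 : ⟪Q.K x, x⟫ = 0 := by rw [real_inner_comm]; exact hK x
    have e4 : ⟪Q.J x, Q.I x⟫ = 0 := by rw [real_inner_comm]; exact hIJ
    have e5 : ⟪Q.K x, Q.I x⟫ = 0 := by rw [real_inner_comm]; exact hIK
    have e6 : ⟪Q.K x, Q.J x⟫ = 0 := by rw [real_inner_comm]; exact hJK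
    simp only [e1, e2, e3, e4, e5, e6]
    ring
  exact (mul_self_inj (norm_nonneg _) (by positivity)).1 key

/-- The identification `a ↦ a e` of the quaternions with Euclidean four-space that is given by a
quaternionic structure and a unit vector `e` (which becomes the quaternion `1`). -/
noncomputable def ident (Q : QuaternionicStructure) (e : E4) (he : ‖e‖ = 1) :
    ℍ[ℝ] ≃ₗᵢ[ℝ] E4 :=
  LinearIsometry.toLinearIsometryEquiv
    { toFun := fun a => Q.act a e
      map_add' := fun a b => by
        simp only [act, Quaternion.re_add, Quaternion.imI_add, Quaternion.imJ_add,
          Quaternion.imK_add]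
        module
      map_smul' := fun t a => by
        simp only [act, Quaternion.re_smul, Quaternion.imI_smul, Quaternion.imJ_smul,
          Quaternion.imK_smul, smul_eq_mul, RingHom.id_apply]
        module
      norm_map' := fun a => by
        change ‖Q.act a e‖ = ‖a‖
        rw [norm_act, he, mul_one] }
    (by rw [Quaternion.finrank_eq_four, finrank_euclideanSpace_fin])

end QuaternionicStructure

/-! ### The quaternionic fractional transformations -/

/-- The partial map `x ↦ (1 - A x)⁻¹ x`, defined where `A x ≠ 1`; quaternion operations are
carried over to Euclidean four-space by the identification `φ`. -/
noncomputable def leftTransformation (φ : ℍ[ℝ] ≃ₗᵢ[ℝ] E4) (A : E4 →ₗ[ℝ] E4) : E4 →. E4 :=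
  fun x => ⟨φ.symm (A x) ≠ 1, fun _ => φ ((1 - φ.symm (A x))⁻¹ * φ.symm x)⟩

/-- The partial map `x ↦ x (1 - A x)⁻¹`, defined where `A x ≠ 1`. -/
noncomputable def rightTransformation (φ : ℍ[ℝ] ≃ₗᵢ[ℝ] E4) (A : E4 →ₗ[ℝ] E4) : E4 →. E4 :=
  fun x => ⟨φ.symm (A x) ≠ 1, fun _ => φ (φ.symm x * (1 - φ.symm (A x))⁻¹)⟩

/-- The transformation `T` takes the line `l` through the origin to the circle `c`: it takes the
germ of `l` at the origin onto the germ of `c`, and `c` is the closure of the image of `l`. -/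
def TakesTo (T : E4 →. E4) (l c : Set E4) : Prop :=
  (∀ U ∈ 𝓝 (0 : E4), ∀ᶠ y in 𝓝 (0 : E4), (y ∈ T.image (l ∩ U) ↔ y ∈ c)) ∧
    closure (T.image l) = c

/-!
A rectifying diffeomorphism may be normalised so that its inverse `Ψ` has linear part the identity
and takes the tangent line of every circle of the bundle to the circle. Let `a`, `b`, `c` be the
Taylor terms of `Ψ` of degrees two, three and four, so that the circle with tangent vector `v` is
parametrised by `t v + t² a(v) + t³ b(v) + t⁴ c(v) + …`. That this curve lies on a circle gives one
vector equation in each of the degrees three and four (`coefficients_of_curve_on_circle`,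
`CircleConditions`). Their coordinates are polynomials in `v` of degree at most eight; if they
vanish at points in general position they vanish identically
(`exists_generalPosition_polynomial`, `circleConditions_of_generalPosition`).

The polynomial `|v|²` is prime, and modulo `|v|²` the two equations say that `⟨v, a(v)⟩` and
`|a(v)|²` vanish (`dvd_of_circle_conditions`). So on the complex null cone the isotropic vector
`a(v)` is orthogonal to the isotropic vector `v`, and therefore lies in one of the two isotropic
planes through `v`, which are the left and the right ideal of the complexified quaternions
generated by `v`. In algebraic terms, one of `a(v) v̄` and `v̄ a(v)` is divisible by `|v|²`
(`Quaternion.mul_star_eq_zero_or_star_mul_eq_zero`); the quotient `A` is linear, and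
`a(v) = A(v) v` or `a(v) = v A(v)` (`exists_linear_of_circle_conditions`). This is the second order
term of the transformation `L_A` or `R_A`. Since `L_A` takes the line spanned by `v` to the circle
`{y | v y⁻¹ + A(v) ∈ ℝ}` (`takesTo_leftTransformation`), and a circle is determined by its tangent
vector and its second order term, the transformation takes every tangent line to its circle.
Conjugation exchanges `L_A` and `R_A`, so only left transformations need to be studied, for an
arbitrary isometric identification of the space with the quaternions.

For the second part, two identifications with the quaternions differ by an isometry of `ℍ`, which
is `x ↦ p σ(x)` or `x ↦ p σ(x̄)` with an automorphism `σ` (`exists_algEquiv_of_isometry`). The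
former preserves the sets of left and of right transformations, the latter exchanges them.
-/

/-! ### Polynomials: the norm form is prime -/

/-- A real polynomial of degree at most one is an affine function. -/
theorem exists_affine_of_totalDegree_le_one {n : ℕ} (p : MvPolynomial (Fin n) ℝ)
    (hp : p.totalDegree ≤ 1) :
    ∃ (c : ℝ) (l : Fin n → ℝ), ∀ x, MvPolynomial.eval x p = c + ∑ i, l i * x i := by
  suffices h : ∃ (c : ℝ) (l : Fin n → ℝ), ∀ x : Fin n → ℝ,
      (∑ d ∈ p.support, fun x : Fin n → ℝ => p.coeff d * ∏ i ∈ d.support, x i ^ d i) x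
        = c + ∑ i, l i * x i by
    obtain ⟨c, l, h⟩ := h
    refine ⟨c, l, fun x => ?_⟩
    rw [← h x, MvPolynomial.eval_eq, Finset.sum_apply]
  refine Finset.sum_induction _
    (fun f : (Fin n → ℝ) → ℝ => ∃ (c : ℝ) (l : Fin n → ℝ), ∀ x, f x = c + ∑ i, l i * x i) ?_ ?_ ?_
  · rintro f g ⟨c, l, h⟩ ⟨c', l', h'⟩
    refine ⟨c + c', l + l', fun x => ?_⟩
    simp only [Pi.add_apply, h, h', add_mul, Finset.sum_add_distrib]
    ring
  · exact ⟨0, 0, fun x => by simp⟩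
  · intro d hd
    have h1 : d.sum (fun _ e => e) ≤ 1 := (MvPolynomial.le_totalDegree hd).trans hp
    rw [Finsupp.sum_fintype _ _ (fun _ => rfl)] at h1
    by_cases h0 : d = 0
    · exact ⟨p.coeff d, 0, fun x => by simp [h0]⟩
    · obtain ⟨i, hi⟩ := Finsupp.ne_iff.1 h0
      rw [Finsupp.zero_apply] at hi
      have hd' : d = Finsupp.single i 1 := by
        ext j
        rcases eq_or_ne i j with rfl | hij
        · have := Finset.single_le_sum (f := fun j => d j) (fun _ _ => Nat.zero_le _)
            (Finset.mem_univ i)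
          simp only [Finsupp.single_eq_same]
          omega
        · have h2 := Finset.sum_le_sum_of_subset (f := fun j => d j) (Finset.subset_univ {i, j})
          rw [Finset.sum_pair hij] at h2
          rw [Finsupp.single_eq_of_ne (by exact hij.symm)]
          omega
      refine ⟨0, Pi.single i (p.coeff d), fun x => ?_⟩
      rw [Finset.sum_eq_single i (fun j _ hj => by simp [hj]) (by simp)]
      simp [hd']

/-- The polynomial `|x|²` in four variables. -/
noncomputable def normPoly : MvPolynomial (Fin 4) ℝ := ∑ i, MvPolynomial.X i ^ 2

theorem eval_normPoly (x : Fin 4 → ℝ) : MvPolynomial.eval x normPoly = ∑ i, x i ^ 2 := by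
  simp [normPoly]

theorem eval_normPoly_ne_zero {x : Fin 4 → ℝ} (hx : x ≠ 0) :
    MvPolynomial.eval x normPoly ≠ 0 := by
  rw [eval_normPoly]
  obtain ⟨i, hi⟩ := Function.ne_iff.1 hx
  exact (Finset.sum_pos' (fun j _ => sq_nonneg _)
    ⟨i, Finset.mem_univ i, sq_pos_of_ne_zero hi⟩).ne'

theorem normPoly_ne_zero : normPoly ≠ 0 := by
  intro h
  have := eval_normPoly_ne_zero (x := fun _ => 1) (Function.ne_iff.2 ⟨0, by simp⟩)
  simp [h] at this

theorem isHomogeneous_normPoly : normPoly.IsHomogeneous 2 :=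
  MvPolynomial.IsHomogeneous.sum _ _ _ fun i _ => by
    simpa using (MvPolynomial.isHomogeneous_X ℝ i).pow 2

theorem totalDegree_normPoly : normPoly.totalDegree = 2 :=
  isHomogeneous_normPoly.totalDegree normPoly_ne_zero

/-- A polynomial of degree one in four variables has a nonzero real root. -/
theorem exists_root_of_totalDegree_eq_one (p : MvPolynomial (Fin 4) ℝ)
    (hp : p.totalDegree = 1) : ∃ x : Fin 4 → ℝ, x ≠ 0 ∧ MvPolynomial.eval x p = 0 := by
  obtain ⟨c, l, h⟩ := exists_affine_of_totalDegree_le_one p hp.le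
  by_cases hl : l = 0
  · have : p = MvPolynomial.C c := MvPolynomial.funext fun x => by simp [h, hl]
    rw [this, MvPolynomial.totalDegree_C] at hp
    exact absurd hp (by norm_num)
  · obtain ⟨i, hi⟩ := Function.ne_iff.1 hl
    rw [Pi.zero_apply] at hi
    obtain ⟨j, hij⟩ := exists_ne i
    refine ⟨Pi.single j 1 + Pi.single i ((-c - l j) / l i), Function.ne_iff.2 ⟨j, ?_⟩, ?_⟩
    · simp [Pi.single_eq_of_ne hij]
    · rw [h]
      simp only [Pi.add_apply, mul_add, Finset.sum_add_distrib]
      rw [Finset.sum_eq_single j (fun k _ hk => by simp [hk]) (by simp),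
        Finset.sum_eq_single i (fun k _ hk => by simp [hk]) (by simp)]
      simp only [Pi.single_eq_same]
      field_simp
      ring

/-- A factor of degree one would have a real root off the origin, where `|x|²` does not vanish. -/
theorem prime_normPoly : Prime normPoly := by
  refine Irreducible.prime ⟨?_, ?_⟩
  · intro h
    have := (MvPolynomial.isUnit_iff_totalDegree_of_isReduced.1 h).2
    rw [totalDegree_normPoly] at this
    exact absurd this (by norm_num)
  · intro f g hfg
    have hf : f ≠ 0 := by rintro rfl; exact normPoly_ne_zero (by simpa using hfg)
    have hg : g ≠ 0 := by rintro rfl; exact normPoly_ne_zero (by simpa using hfg)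
    have hdeg := MvPolynomial.totalDegree_mul_of_isDomain hf hg
    rw [← hfg, totalDegree_normPoly] at hdeg
    have unit : ∀ p : MvPolynomial (Fin 4) ℝ, p ≠ 0 → p.totalDegree = 0 → IsUnit p := by
      intro p hp h0
      rw [MvPolynomial.totalDegree_eq_zero_iff_eq_C] at h0
      rw [h0] at hp ⊢
      exact (isUnit_iff_ne_zero.2 fun h => hp (by rw [h, map_zero])).map MvPolynomial.C
    have key : ∀ p r : MvPolynomial (Fin 4) ℝ, normPoly = p * r → p.totalDegree ≠ 1 := by
      intro p r hpr h1
      obtain ⟨x, hx, hx0⟩ := exists_root_of_totalDegree_eq_one p h1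
      exact eval_normPoly_ne_zero hx (by rw [hpr, map_mul, hx0, zero_mul])
    have := key f g hfg
    rcases (by omega : f.totalDegree = 0 ∨ g.totalDegree = 0) with h | h
    · exact Or.inl (unit f hf h)
    · exact Or.inr (unit g hg h)

theorem not_normPoly_dvd_X (i : Fin 4) : ¬ normPoly ∣ MvPolynomial.X i := by
  intro h
  have := MvPolynomial.totalDegree_le_of_dvd_of_isDomain h (MvPolynomial.X_ne_zero i)
  rw [totalDegree_normPoly, MvPolynomial.totalDegree_X] at this
  exact absurd this (by norm_num)

/-! ### The algebra of the circle conditions -/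

/-- The third and fourth order circle conditions for the curves `t v + t² a + t³ b + t⁴ c`, seen
as identities over a ring of polynomials in which `|v|²` is prime, make `⟨v, a⟩` and `|a|²`
divisible by `|v|²`: modulo `|v|²` the first reads `⟨v, a⟩² v = 0` and the second, paired with
`a`, reads `|a|⁴ = 0`. -/
theorem dvd_of_circle_conditions {R ι : Type*} [CommRing R] [IsDomain R] [Fintype ι]
    {q : R} {v a b c : ι → R} (hq : Prime q) (h2 : IsUnit (2 : R)) (i₀ : ι) (hv : ¬ q ∣ v i₀)
    (h3 : ∀ i, q * (q * b i - (b ⬝ᵥ v) * v i) = 2 * (v ⬝ᵥ a) * (q * a i - (a ⬝ᵥ v) * v i))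
    (h4 : ∀ i, q * (q * c i - (c ⬝ᵥ v) * v i)
      = (a ⬝ᵥ a + 2 * (v ⬝ᵥ b)) * (q * a i - (a ⬝ᵥ v) * v i)) :
    q ∣ v ⬝ᵥ a ∧ q ∣ a ⬝ᵥ a := by
  have hq0 := hq.ne_zero
  have hs : q ∣ v ⬝ᵥ a := by
    have h : q ∣ 2 * ((v ⬝ᵥ a) * (v ⬝ᵥ a) * v i₀) := by
      refine ⟨2 * (v ⬝ᵥ a) * a i₀ - (q * b i₀ - (b ⬝ᵥ v) * v i₀), ?_⟩
      have := h3 i₀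
      rw [dotProduct_comm a v] at this
      linear_combination this
    rw [h2.dvd_mul_left] at h
    rcases hq.dvd_or_dvd h with h | h
    · rcases hq.dvd_or_dvd h with h | h <;> exact h
    · exact absurd h hv
  refine ⟨hs, ?_⟩
  obtain ⟨l, hl⟩ := hs
  rw [dotProduct_comm a v, hl] at h3 h4
  have h3' : ∀ i, q * b i - (b ⬝ᵥ v) * v i = 2 * l * q * (a i - l * v i) := fun i =>
    mul_left_cancel₀ hq0 (by linear_combination h3 i)
  have hb : q ∣ v ⬝ᵥ b := by
    have h : q ∣ (b ⬝ᵥ v) * v i₀ :=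
      ⟨b i₀ - 2 * l * (a i₀ - l * v i₀), by linear_combination -h3' i₀⟩
    rcases hq.dvd_or_dvd h with h | h
    · rwa [dotProduct_comm]
    · exact absurd h hv
  obtain ⟨m, hm⟩ := hb
  rw [hm] at h4
  have h4' : ∀ i, q * c i - (c ⬝ᵥ v) * v i = (a ⬝ᵥ a + 2 * (q * m)) * (a i - l * v i) :=
    fun i => mul_left_cancel₀ hq0 (by linear_combination h4 i)
  have h5 : q * (c ⬝ᵥ a) - (c ⬝ᵥ v) * (v ⬝ᵥ a)
      = (a ⬝ᵥ a + 2 * (q * m)) * (a ⬝ᵥ a - l * (v ⬝ᵥ a)) := by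
    have h6 : ∑ i, (q * c i - (c ⬝ᵥ v) * v i) * a i
        = ∑ i, (a ⬝ᵥ a + 2 * (q * m)) * (a i - l * v i) * a i :=
      Finset.sum_congr rfl fun i _ => by rw [h4' i]
    simp only [sub_mul, mul_assoc, mul_sub, Finset.sum_sub_distrib, ← Finset.mul_sum] at h6
    simp only [dotProduct] at h6 ⊢
    linear_combination h6
  have h7 : q ∣ (a ⬝ᵥ a) * (a ⬝ᵥ a) := by
    refine ⟨(c ⬝ᵥ a) - (c ⬝ᵥ v) * l - 2 * m * (a ⬝ᵥ a - l * (q * l)) + (a ⬝ᵥ a) * (l * l), ?_⟩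
    rw [hl] at h5
    linear_combination -h5
  rcases hq.dvd_or_dvd h7 with h | h <;> exact h

/-- The quaternion with given four coordinates. -/
def quatOf {R : Type*} [CommRing R] (x : Fin 4 → R) : ℍ[R] := ⟨x 0, x 1, x 2, x 3⟩

section quatOf

variable {R : Type*} [CommRing R] (x : Fin 4 → R)

@[simp] theorem quatOf_re : (quatOf x).re = x 0 := rfl

@[simp] theorem quatOf_imI : (quatOf x).imI = x 1 := rfl

@[simp] theorem quatOf_imJ : (quatOf x).imJ = x 2 := rfl

@[simp] theorem quatOf_imK : (quatOf x).imK = x 3 := rfl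

end quatOf

/-- Quaternions over a domain of characteristic other than two form a prime ring. -/
theorem Quaternion.eq_zero_or_eq_zero_of_forall_mul_mul {D : Type*} [CommRing D] [IsDomain D]
    (h2 : (2 : D) ≠ 0) {x y : ℍ[D]} (h : ∀ g : ℍ[D], x * g * y = 0) : x = 0 ∨ y = 0 := by
  by_contra! hxy
  obtain ⟨hx, hy⟩ := hxy
  have h4 : (4 : D) ≠ 0 := by
    have : (4 : D) = 2 * 2 := by norm_num
    rw [this]
    exact mul_ne_zero h2 h2
  -- averaging over the quaternion units extracts the real part of the right factor
  have key : ∀ z : ℍ[D], (∀ g : ℍ[D], x * g * z = 0) → z.re = 0 := by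
    intro z hz
    by_contra hne
    apply hx
    have e : (4 * z.re) • x = x * 1 * z * 1 - x * (quatOf ![0, 1, 0, 0]) * z * (quatOf ![0, 1, 0, 0])
        - x * (quatOf ![0, 0, 1, 0]) * z * (quatOf ![0, 0, 1, 0]) - x * (quatOf ![0, 0, 0, 1]) * z * (quatOf ![0, 0, 0, 1]) := by
      ext <;> simp <;> ring
    rw [hz, hz, hz, hz] at e
    simp only [zero_mul, sub_zero] at e
    exact (smul_eq_zero.1 e).resolve_left (mul_ne_zero h4 hne)
  apply hy
  have hr : ∀ u : ℍ[D], (y * u).re = 0 := fun u =>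
    key _ fun g => by rw [← mul_assoc, h g, zero_mul]
  have e0 := hr 1
  have e1 := hr (quatOf ![0, 1, 0, 0])
  have e2 := hr (quatOf ![0, 0, 1, 0])
  have e3 := hr (quatOf ![0, 0, 0, 1])
  simp at e0 e1 e2 e3
  ext <;> assumption

/-- Two orthogonal isotropic quaternions `v` and `a` over a domain lie in a common left ideal or
in a common right ideal: `a v̄ g v̄ a = 0` for every `g`, because
`v̄ g v̄ = 2 ⟨v, g⟩ v̄ - |v|² ḡ` and `a v̄ a = 2 ⟨a, v⟩ a - |a|² v`. -/
theorem Quaternion.mul_star_eq_zero_or_star_mul_eq_zero {D : Type*} [CommRing D] [IsDomain D]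
    (h2 : (2 : D) ≠ 0) {v a : ℍ[D]} (hv : v * star v = 0) (ha : a * star a = 0)
    (hva : (a * star v).re = 0) : a * star v = 0 ∨ star v * a = 0 := by
  refine Quaternion.eq_zero_or_eq_zero_of_forall_mul_mul h2 fun g => ?_
  have h1 : a * star v = -(v * star a) := by
    have := Quaternion.self_add_star' (a * star v)
    rw [hva, mul_zero, Quaternion.coe_zero, star_mul, star_star] at this
    exact eq_neg_of_add_eq_zero_left this
  have h3 : star v * g * star v = (2 * (star v * g).re) • star v := by
    have h4 := Quaternion.self_add_star' (star v * g)
    have h5 : star v * g * star v = (star v * g + star (star v * g)) * star v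
        - star g * (v * star v) := by
      simp only [star_mul, star_star]
      noncomm_ring
    rw [h5, h4, hv, mul_zero, sub_zero, Quaternion.coe_mul_eq_smul]
  have h6 : star a * a = 0 := by
    rw [Quaternion.star_mul_self, ← Quaternion.self_mul_star, ha]
  calc a * star v * g * (star v * a) = a * (star v * g * star v) * a := by noncomm_ring
    _ = (2 * (star v * g).re) • (a * star v * a) := by
      rw [h3, mul_smul_comm, smul_mul_assoc]
    _ = 0 := by rw [h1, neg_mul, mul_assoc, h6, mul_zero, neg_zero, smul_zero]

/-! ### Second order terms of curves that satisfy the circle conditions -/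

/-- A function on `ℝⁿ` that is a polynomial of degree at most `d`. -/
def IsPolyFun {n : ℕ} (d : ℕ) (f : (Fin n → ℝ) → ℝ) : Prop :=
  ∃ p : MvPolynomial (Fin n) ℝ, p.totalDegree ≤ d ∧ ∀ x, MvPolynomial.eval x p = f x

/-- A cubic form divisible by `|x|²` has a linear quotient. -/
theorem exists_linear_of_normPoly_dvd {p : MvPolynomial (Fin 4) ℝ} (hdeg : p.totalDegree ≤ 3)
    (hp : ∀ x : Fin 4 → ℝ, MvPolynomial.eval ((2 : ℝ) • x) p = 8 * MvPolynomial.eval x p)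
    (hdvd : normPoly ∣ p) :
    ∃ l : Fin 4 → ℝ, ∀ x, MvPolynomial.eval x p = (∑ i, x i ^ 2) * ∑ i, l i * x i := by
  obtain ⟨r, rfl⟩ := hdvd
  by_cases hr : r = 0
  · exact ⟨0, fun x => by simp [hr]⟩
  rw [MvPolynomial.totalDegree_mul_of_isDomain normPoly_ne_zero hr, totalDegree_normPoly] at hdeg
  obtain ⟨c, l, h⟩ := exists_affine_of_totalDegree_le_one r (by omega)
  refine ⟨l, fun x => ?_⟩
  have hc : c = 0 := by
    have h1 := hp 1
    simp only [map_mul, eval_normPoly, h, Fin.sum_univ_four, Pi.smul_apply, Pi.one_apply,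
      smul_eq_mul] at h1
    linarith
  rw [map_mul, eval_normPoly, h, hc, zero_add]

theorem quatOf_mul_star_self {R : Type*} [CommRing R] (x : Fin 4 → R) :
    quatOf x * star (quatOf x) = ((x ⬝ᵥ x : R) : ℍ[R]) := by
  ext <;> simp [dotProduct, Fin.sum_univ_four] <;> ring

theorem star_mul_quatOf_self {R : Type*} [CommRing R] (x : Fin 4 → R) :
    star (quatOf x) * quatOf x = ((x ⬝ᵥ x : R) : ℍ[R]) := by
  ext <;> simp [dotProduct, Fin.sum_univ_four] <;> ring

theorem quatOf_mul_star_re {R : Type*} [CommRing R] (x y : Fin 4 → R) :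
    (quatOf x * star (quatOf y)).re = x ⬝ᵥ y := by
  simp [dotProduct, Fin.sum_univ_four]

/-- The map on quaternions induced by a ring homomorphism of the coefficients. -/
def quatMap {R S : Type*} [CommRing R] [CommRing S] (f : R →+* S) (x : ℍ[R]) : ℍ[S] :=
  ⟨f x.re, f x.imI, f x.imJ, f x.imK⟩

section quatMap

variable {R S : Type*} [CommRing R] [CommRing S] (f : R →+* S)

@[simp] theorem quatMap_re (x : ℍ[R]) : (quatMap f x).re = f x.re := rfl

@[simp] theorem quatMap_imI (x : ℍ[R]) : (quatMap f x).imI = f x.imI := rfl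

@[simp] theorem quatMap_imJ (x : ℍ[R]) : (quatMap f x).imJ = f x.imJ := rfl

@[simp] theorem quatMap_imK (x : ℍ[R]) : (quatMap f x).imK = f x.imK := rfl

theorem quatMap_mul (x y : ℍ[R]) : quatMap f (x * y) = quatMap f x * quatMap f y := by
  ext <;> simp

theorem quatMap_star (x : ℍ[R]) : quatMap f (star x) = star (quatMap f x) := by
  ext <;> simp

theorem quatMap_quatOf (x : Fin 4 → R) : quatMap f (quatOf x) = quatOf (f ∘ x) := rfl

end quatMap

/-- The quaternionic form of `exists_linear_of_normPoly_dvd`. -/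
theorem exists_linear_quatOf_of_normPoly_dvd (p : ℍ[MvPolynomial (Fin 4) ℝ])
    (hre : p.re.totalDegree ≤ 3) (hI : p.imI.totalDegree ≤ 3) (hJ : p.imJ.totalDegree ≤ 3)
    (hK : p.imK.totalDegree ≤ 3)
    (hp : ∀ x : Fin 4 → ℝ, quatMap (MvPolynomial.eval ((2 : ℝ) • x)) p
      = (8 : ℝ) • quatMap (MvPolynomial.eval x) p)
    (hdvd : quatMap (Ideal.Quotient.mk (Ideal.span {normPoly})) p = 0) :
    ∃ A : (Fin 4 → ℝ) →ₗ[ℝ] Fin 4 → ℝ, ∀ x,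
      quatMap (MvPolynomial.eval x) p = (x ⬝ᵥ x) • quatOf (A x) := by
  have hπ : ∀ r : MvPolynomial (Fin 4) ℝ,
      Ideal.Quotient.mk (Ideal.span {normPoly}) r = 0 → normPoly ∣ r := fun r hr => by
    rwa [Ideal.Quotient.eq_zero_iff_mem, Ideal.mem_span_singleton] at hr
  obtain ⟨l0, h0⟩ := exists_linear_of_normPoly_dvd hre
    (fun x => congrArg QuaternionAlgebra.re (hp x)) (hπ _ (congrArg QuaternionAlgebra.re hdvd))
  obtain ⟨l1, h1⟩ := exists_linear_of_normPoly_dvd hI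
    (fun x => congrArg QuaternionAlgebra.imI (hp x)) (hπ _ (congrArg QuaternionAlgebra.imI hdvd))
  obtain ⟨l2, h2⟩ := exists_linear_of_normPoly_dvd hJ
    (fun x => congrArg QuaternionAlgebra.imJ (hp x)) (hπ _ (congrArg QuaternionAlgebra.imJ hdvd))
  obtain ⟨l3, h3⟩ := exists_linear_of_normPoly_dvd hK
    (fun x => congrArg QuaternionAlgebra.imK (hp x)) (hπ _ (congrArg QuaternionAlgebra.imK hdvd))
  refine ⟨Matrix.mulVecLin (Matrix.of ![l0, l1, l2, l3]), fun x => ?_⟩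
  ext <;> simp [h0, h1, h2, h3, dotProduct, sq]

/-- If `a(x) x̄` vanishes modulo `|x|²`, then `a(x) = A(x) x` for a linear `A`. -/
theorem exists_linear_mul_quatOf {a : (Fin 4 → ℝ) → Fin 4 → ℝ}
    {pa : Fin 4 → MvPolynomial (Fin 4) ℝ} (hpad : ∀ i, (pa i).totalDegree ≤ 2)
    (hpa : ∀ i x, MvPolynomial.eval x (pa i) = a x i)
    (ha2 : ∀ x, a ((2 : ℝ) • x) = (4 : ℝ) • a x)
    (h : quatMap (Ideal.Quotient.mk (Ideal.span {normPoly}))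
      (quatOf pa * star (quatOf MvPolynomial.X)) = 0) :
    ∃ A : (Fin 4 → ℝ) →ₗ[ℝ] Fin 4 → ℝ, ∀ x, quatOf (a x) = quatOf (A x) * quatOf x := by
  have hmem : ∀ i j, pa i * MvPolynomial.X j ∈ MvPolynomial.restrictTotalDegree (Fin 4) ℝ 3 := by
    intro i j
    rw [MvPolynomial.mem_restrictTotalDegree]
    refine (MvPolynomial.totalDegree_mul _ _).trans ?_
    rw [MvPolynomial.totalDegree_X]
    exact Nat.add_le_add_right (hpad i) 1
  have ha0 : a 0 = 0 := by
    have := ha2 0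
    rw [smul_zero] at this
    ext i
    have := congrFun this i
    simp only [Pi.smul_apply, smul_eq_mul] at this
    simp only [Pi.zero_apply]
    linarith
  have eV : ∀ x : Fin 4 → ℝ,
      quatMap (MvPolynomial.eval x) (quatOf MvPolynomial.X) = quatOf x := fun x => by
    rw [quatMap_quatOf]
    congr 1
    exact funext fun i => MvPolynomial.eval_X i
  have eW : ∀ x, quatMap (MvPolynomial.eval x) (quatOf pa) = quatOf (a x) := fun x => by
    rw [quatMap_quatOf]
    congr 1
    exact funext fun i => hpa i x
  have hdbl : ∀ u w : Fin 4 → ℝ, quatOf ((4 : ℝ) • u) * star (quatOf ((2 : ℝ) • w))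
      = (8 : ℝ) • (quatOf u * star (quatOf w)) := fun u w => by
    ext <;> simp <;> ring
  have hd : ∀ p : ℍ[MvPolynomial (Fin 4) ℝ], p = quatOf pa * star (quatOf MvPolynomial.X) →
      p.re.totalDegree ≤ 3 ∧ p.imI.totalDegree ≤ 3 ∧ p.imJ.totalDegree ≤ 3 ∧
        p.imK.totalDegree ≤ 3 := by
    rintro p rfl
    simp only [← MvPolynomial.mem_restrictTotalDegree, Quaternion.re_mul, Quaternion.imI_mul,
      Quaternion.imJ_mul, Quaternion.imK_mul, Quaternion.re_star, Quaternion.imI_star,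
      Quaternion.imJ_star, Quaternion.imK_star, mul_neg]
    refine ⟨?_, ?_, ?_, ?_⟩ <;>
      repeat' first | apply add_mem | apply sub_mem | apply neg_mem | apply hmem
  obtain ⟨hd0, hd1, hd2, hd3⟩ := hd _ rfl
  obtain ⟨A, hA⟩ := exists_linear_quatOf_of_normPoly_dvd _ hd0 hd1 hd2 hd3
    (fun x => by rw [quatMap_mul, quatMap_star, eV, eW, ha2, hdbl, quatMap_mul, quatMap_star,
      eV, eW]) h
  refine ⟨A, fun x => ?_⟩
  by_cases hx : x = 0
  · rw [hx, ha0, show quatOf (0 : Fin 4 → ℝ) = 0 from rfl, mul_zero]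
  have hxx : (x ⬝ᵥ x) ≠ 0 := by simpa using hx
  have e := hA x
  rw [quatMap_mul, quatMap_star, eV, eW] at e
  have e2 := congrArg (· * quatOf x) e
  simp only [mul_assoc, star_mul_quatOf_self, smul_mul_assoc] at e2
  rw [← Quaternion.coe_commutes, Quaternion.coe_mul_eq_smul] at e2
  exact smul_right_injective _ hxx e2

/-- If `x̄ a(x)` vanishes modulo `|x|²`, then `a(x) = x A(x)` for a linear `A`. -/
theorem exists_linear_quatOf_mul {a : (Fin 4 → ℝ) → Fin 4 → ℝ}
    {pa : Fin 4 → MvPolynomial (Fin 4) ℝ} (hpad : ∀ i, (pa i).totalDegree ≤ 2)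
    (hpa : ∀ i x, MvPolynomial.eval x (pa i) = a x i)
    (ha2 : ∀ x, a ((2 : ℝ) • x) = (4 : ℝ) • a x)
    (h : quatMap (Ideal.Quotient.mk (Ideal.span {normPoly}))
      (star (quatOf MvPolynomial.X) * quatOf pa) = 0) :
    ∃ A : (Fin 4 → ℝ) →ₗ[ℝ] Fin 4 → ℝ, ∀ x, quatOf (a x) = quatOf x * quatOf (A x) := by
  have hmem : ∀ i j, MvPolynomial.X j * pa i ∈ MvPolynomial.restrictTotalDegree (Fin 4) ℝ 3 := by
    intro i j
    rw [MvPolynomial.mem_restrictTotalDegree]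
    rw [mul_comm]
    refine (MvPolynomial.totalDegree_mul _ _).trans ?_
    rw [MvPolynomial.totalDegree_X]
    exact Nat.add_le_add_right (hpad i) 1
  have ha0 : a 0 = 0 := by
    have := ha2 0
    rw [smul_zero] at this
    ext i
    have := congrFun this i
    simp only [Pi.smul_apply, smul_eq_mul] at this
    simp only [Pi.zero_apply]
    linarith
  have eV : ∀ x : Fin 4 → ℝ,
      quatMap (MvPolynomial.eval x) (quatOf MvPolynomial.X) = quatOf x := fun x => by
    rw [quatMap_quatOf]
    congr 1
    exact funext fun i => MvPolynomial.eval_X i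
  have eW : ∀ x, quatMap (MvPolynomial.eval x) (quatOf pa) = quatOf (a x) := fun x => by
    rw [quatMap_quatOf]
    congr 1
    exact funext fun i => hpa i x
  have hdbl : ∀ u w : Fin 4 → ℝ, star (quatOf ((2 : ℝ) • w)) * quatOf ((4 : ℝ) • u)
      = (8 : ℝ) • (star (quatOf w) * quatOf u) := fun u w => by
    ext <;> simp <;> ring
  have hd : ∀ p : ℍ[MvPolynomial (Fin 4) ℝ], p = star (quatOf MvPolynomial.X) * quatOf pa →
      p.re.totalDegree ≤ 3 ∧ p.imI.totalDegree ≤ 3 ∧ p.imJ.totalDegree ≤ 3 ∧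
        p.imK.totalDegree ≤ 3 := by
    rintro p rfl
    simp only [← MvPolynomial.mem_restrictTotalDegree, Quaternion.re_mul, Quaternion.imI_mul,
      Quaternion.imJ_mul, Quaternion.imK_mul, Quaternion.re_star, Quaternion.imI_star,
      Quaternion.imJ_star, Quaternion.imK_star, neg_mul]
    refine ⟨?_, ?_, ?_, ?_⟩ <;>
      repeat' first | apply add_mem | apply sub_mem | apply neg_mem | apply hmem
  obtain ⟨hd0, hd1, hd2, hd3⟩ := hd _ rfl
  obtain ⟨A, hA⟩ := exists_linear_quatOf_of_normPoly_dvd _ hd0 hd1 hd2 hd3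
    (fun x => by rw [quatMap_mul, quatMap_star, eV, eW, ha2, hdbl, quatMap_mul, quatMap_star,
      eV, eW]) h
  refine ⟨A, fun x => ?_⟩
  by_cases hx : x = 0
  · rw [hx, ha0, show quatOf (0 : Fin 4 → ℝ) = 0 from rfl, zero_mul]
  have hxx : (x ⬝ᵥ x) ≠ 0 := by simpa using hx
  have e := hA x
  rw [quatMap_mul, quatMap_star, eV, eW] at e
  have e2 := congrArg (quatOf x * ·) e
  simp only [← mul_assoc, quatOf_mul_star_self, mul_smul_comm] at e2
  rw [Quaternion.coe_mul_eq_smul] at e2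
  exact smul_right_injective _ hxx e2

/-- If the second order coefficient `a` of a family of curves satisfies the circle conditions,
then `a (x)` is `A (x) x` or `x A (x)` as a product of quaternions, with a linear `A`. -/
theorem exists_linear_of_circle_conditions {d : ℕ} {a b c : (Fin 4 → ℝ) → Fin 4 → ℝ}
    (ha : ∀ i, IsPolyFun 2 fun x => a x i) (hb : ∀ i, IsPolyFun d fun x => b x i)
    (hc : ∀ i, IsPolyFun d fun x => c x i) (ha2 : ∀ x, a ((2 : ℝ) • x) = (4 : ℝ) • a x)
    (h3 : ∀ x i, (x ⬝ᵥ x) * ((x ⬝ᵥ x) * b x i - (b x ⬝ᵥ x) * x i)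
      = 2 * (x ⬝ᵥ a x) * ((x ⬝ᵥ x) * a x i - (a x ⬝ᵥ x) * x i))
    (h4 : ∀ x i, (x ⬝ᵥ x) * ((x ⬝ᵥ x) * c x i - (c x ⬝ᵥ x) * x i)
      = (a x ⬝ᵥ a x + 2 * (x ⬝ᵥ b x)) * ((x ⬝ᵥ x) * a x i - (a x ⬝ᵥ x) * x i)) :
    (∃ A : (Fin 4 → ℝ) →ₗ[ℝ] Fin 4 → ℝ, ∀ x, quatOf (a x) = quatOf (A x) * quatOf x) ∨
      ∃ A : (Fin 4 → ℝ) →ₗ[ℝ] Fin 4 → ℝ, ∀ x, quatOf (a x) = quatOf x * quatOf (A x) := by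
  choose pa hpad hpa using ha
  choose pb _ hpb using hb
  choose pc _ hpc using hc
  let v : Fin 4 → MvPolynomial (Fin 4) ℝ := MvPolynomial.X
  have hq : normPoly = v ⬝ᵥ v := by simp [normPoly, dotProduct, v, sq]
  have ev : ∀ x i, MvPolynomial.eval x (v i) = x i := fun x i => MvPolynomial.eval_X i
  have two : IsUnit (2 : MvPolynomial (Fin 4) ℝ) := by
    have := (isUnit_iff_ne_zero.2 (two_ne_zero : (2 : ℝ) ≠ 0)).map
      (MvPolynomial.C (σ := Fin 4))
    rwa [map_ofNat] at this
  obtain ⟨d1, d2⟩ := dvd_of_circle_conditions (v := v) (a := pa) (b := pb) (c := pc)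
    prime_normPoly two 0 (not_normPoly_dvd_X 0)
    (fun i => MvPolynomial.funext fun x => by
      rw [hq]
      simpa [dotProduct, hpa, hpb, ev] using h3 x i)
    (fun i => MvPolynomial.funext fun x => by
      rw [hq]
      simpa [dotProduct, hpa, hpb, hpc, ev] using h4 x i)
  -- the coordinate ring of the null cone
  let D := MvPolynomial (Fin 4) ℝ ⧸ Ideal.span {normPoly}
  let π : MvPolynomial (Fin 4) ℝ →+* D := Ideal.Quotient.mk _
  have hπ : ∀ p, π p = 0 ↔ normPoly ∣ p := fun p => by
    rw [Ideal.Quotient.eq_zero_iff_mem, Ideal.mem_span_singleton]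
  have : (Ideal.span {normPoly}).IsPrime :=
    (Ideal.span_singleton_prime normPoly_ne_zero).2 prime_normPoly
  have : IsDomain D := Ideal.Quotient.isDomain _
  have two' : (2 : D) ≠ 0 := by
    have := (two.map π).ne_zero
    rwa [map_ofNat] at this
  let V : ℍ[D] := quatOf (π ∘ v)
  let W : ℍ[D] := quatOf (π ∘ pa)
  have hdot : ∀ f g : Fin 4 → MvPolynomial (Fin 4) ℝ, (π ∘ f) ⬝ᵥ (π ∘ g) = π (f ⬝ᵥ g) :=
    fun f g => by simp [dotProduct]
  have hv : V * star V = 0 := by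
    rw [quatOf_mul_star_self, hdot, (hπ _).2 (dvd_of_eq hq), Quaternion.coe_zero]
  have hw : W * star W = 0 := by
    rw [quatOf_mul_star_self, hdot, (hπ _).2 d2, Quaternion.coe_zero]
  have hwv : (W * star V).re = 0 := by
    rw [quatOf_mul_star_re, hdot, dotProduct_comm, (hπ _).2 d1]
  rcases Quaternion.mul_star_eq_zero_or_star_mul_eq_zero two' hv hw hwv with h | h
  · exact Or.inl (exists_linear_mul_quatOf hpad hpa ha2 (by
      rw [quatMap_mul, quatMap_star]; exact h))
  · exact Or.inr (exists_linear_quatOf_mul hpad hpa ha2 (by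
      rw [quatMap_mul, quatMap_star]; exact h))

/-! ### Points in general position -/

section GeneralPosition

open MvPolynomial

/-- Finitely many points are in general position for polynomials of degree at most `d` as soon as
a polynomial in their coordinates, the determinant of the values of all monomials, is nonzero. -/
theorem exists_generalPosition_polynomial (n d : ℕ) :
    ∃ (N : ℕ) (P : MvPolynomial (Fin N × Fin n) ℝ), P ≠ 0 ∧
      ∀ v : Fin N → Fin n → ℝ, eval (fun p => v p.1 p.2) P ≠ 0 →
        ∀ p : MvPolynomial (Fin n) ℝ, p.totalDegree ≤ d → (∀ i, eval (v i) p = 0) → p = 0 := by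
  classical
  obtain ⟨s, hs⟩ : ∃ s : Finset (Fin n →₀ ℕ), ∀ m, m ∈ s ↔ m.degree ≤ d :=
    ⟨(Finsupp.finite_of_degree_le d).toFinset, fun m => by simp⟩
  let e : Fin s.card ≃ s := s.equivFin.symm
  let M : Matrix (Fin s.card) (Fin s.card) (MvPolynomial (Fin s.card × Fin n) ℝ) :=
    Matrix.of fun i j => monomial ((e j : Fin n →₀ ℕ).mapDomain (Prod.mk i)) 1
  refine ⟨s.card, M.det, ?_, ?_⟩
  · -- the monomials of the Leibniz expansion are pairwise distinct
    let μ : Equiv.Perm (Fin s.card) → (Fin s.card × Fin n →₀ ℕ) := fun σ =>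
      ∑ i, (e i : Fin n →₀ ℕ).mapDomain (Prod.mk (σ i))
    have hμ : ∀ σ i k, μ σ (σ i, k) = (e i : Fin n →₀ ℕ) k := by
      intro σ i k
      simp only [μ, Finsupp.finsetSum_apply]
      rw [Finset.sum_eq_single i]
      · exact Finsupp.mapDomain_apply (Prod.mk_right_injective _) _ _
      · intro j _ hj
        refine Finsupp.mapDomain_of_notMem_range _ _ ?_
        rintro ⟨k', hk'⟩
        exact hj (σ.injective (Prod.ext_iff.1 hk').1)
      · simp
    have hinj : ∀ σ, μ σ = μ 1 → σ = 1 := by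
      intro σ h
      ext i
      have : e i = e (σ i) := by
        ext k
        rw [← hμ σ i k, h]
        exact hμ 1 (σ i) k
      rw [← e.injective this]
      rfl
    have hdet : M.det = ∑ σ, Equiv.Perm.sign σ • monomial (μ σ) (1 : ℝ) := by
      rw [Matrix.det_apply]
      refine Finset.sum_congr rfl fun σ _ => ?_
      congr 1
      simp only [M, μ, Matrix.of_apply]
      rw [monomial_sum_one]
    intro h0
    have := congrArg (coeff (μ 1)) (hdet.symm.trans h0)
    rw [coeff_sum, Finset.sum_eq_single 1] at this
    · simp at this
    · intro σ _ hσ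
      have hne : μ σ ≠ μ 1 := fun h => hσ (hinj σ h)
      rw [Units.smul_def, coeff_smul, coeff_monomial, if_neg hne, smul_zero]
    · simp
  · intro v hv p hp h0
    have hM : (eval fun p : Fin s.card × Fin n => v p.1 p.2).mapMatrix M
        = Matrix.of fun i j => eval (v i) (monomial (e j : Fin n →₀ ℕ) 1) := by
      ext i j
      simp only [M, RingHom.mapMatrix_apply, Matrix.map_apply, Matrix.of_apply]
      rw [← rename_monomial, eval_rename]
      rfl
    rw [RingHom.map_det, hM] at hv
    have hp' : p = ∑ j, monomial (e j : Fin n →₀ ℕ) (coeff (e j : Fin n →₀ ℕ) p) := by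
      rw [e.sum_comp (fun m : s => monomial (m : Fin n →₀ ℕ) (coeff (m : Fin n →₀ ℕ) p)),
        Finset.sum_coe_sort s (fun m => monomial m (coeff m p))]
      conv_lhs => rw [p.as_sum]
      refine Finset.sum_subset (fun m hm => (hs m).2 ?_) fun m _ hm => ?_
      · exact (le_totalDegree hm).trans hp
      · rw [notMem_support_iff.1 hm, monomial_zero]
    have hc := Matrix.eq_zero_of_mulVec_eq_zero hv
      (v := fun j => coeff (e j : Fin n →₀ ℕ) p) (by
        ext i
        have hi := (congrArg (eval (v i)) hp').symm.trans (h0 i)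
        rw [map_sum] at hi
        rw [Pi.zero_apply, ← hi, Matrix.mulVec, dotProduct]
        refine Finset.sum_congr rfl fun j _ => ?_
        rw [Matrix.of_apply, eval_monomial, eval_monomial, one_mul, mul_comm])
    rw [hp']
    exact Finset.sum_eq_zero fun j _ => by rw [congrFun hc j, Pi.zero_apply, monomial_zero]

end GeneralPosition

/-! ### Circles through the origin and fractional transformations -/

/-- The circle through the origin with tangent vector `v` and curvature vector proportional to
`n ⟂ v`; it is a straight line if `n = 0`. -/
def circleThrough (v n : E4) : Set E4 :=
  {x | ‖v‖ ^ 2 • x - ⟪x, v⟫ • v = ‖x‖ ^ 2 • n}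

theorem isClosed_circleThrough (v n : E4) : IsClosed (circleThrough v n) :=
  isClosed_eq (by fun_prop) (by fun_prop)

theorem Quaternion.normSq_smul_eq_mul_star_mul (x y : ℍ[ℝ]) :
    ‖x‖ ^ 2 • y = y * star x * x := by
  rw [mul_assoc, Quaternion.star_mul_self, ← Quaternion.coe_commutes, Quaternion.coe_mul_eq_smul,
    Quaternion.normSq_eq_norm_mul_self, sq]

/-- The equation of the circle with tangent vector `x` and second order term `a x`. -/
theorem Quaternion.circle_equation_iff {x : ℍ[ℝ]} (hx : x ≠ 0) (a y : ℍ[ℝ]) (hy : y ≠ 0) :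
    ‖x‖ ^ 2 • y - ⟪y, x⟫ • x = ‖y‖ ^ 2 • ((a - (a.re : ℍ[ℝ])) * x) ↔
      ∃ r : ℝ, x * y⁻¹ + a = r := by
  have h1 : ‖x‖ ^ 2 • y - ⟪y, x⟫ • x = (y * star x - ((y * star x).re : ℍ[ℝ])) * x := by
    rw [Quaternion.normSq_smul_eq_mul_star_mul, sub_mul, Quaternion.coe_mul_eq_smul,
      Quaternion.inner_def]
  have h2 : x * y⁻¹ = (‖y‖ ^ 2)⁻¹ • (x * star y) := by
    have : y⁻¹ = (Quaternion.normSq y)⁻¹ • star y := rfl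
    rw [this, mul_smul_comm, Quaternion.normSq_eq_norm_mul_self, sq]
  have hy2 : ‖y‖ ^ 2 ≠ 0 := by simpa using hy
  rw [h1, ← smul_mul_assoc, mul_left_inj' hx, h2]
  generalize ‖y‖ ^ 2 = s at hy2
  rw [Quaternion.ext_iff]
  constructor
  · rintro ⟨-, h2, h3, h4⟩
    obtain ⟨r, hr⟩ : ∃ r : ℝ, r = s⁻¹ * (x * star y).re + a.re := ⟨_, rfl⟩
    refine ⟨r, ?_⟩
    simp at hr
    simp at h2 h3 h4
    ext <;> simp <;> field_simp
    · rw [hr]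
      field_simp
    · linear_combination -h2
    · linear_combination -h3
    · linear_combination -h4
  · rintro ⟨r, hr⟩
    rw [Quaternion.ext_iff] at hr
    obtain ⟨-, h2, h3, h4⟩ := hr
    simp at h2 h3 h4
    field_simp at h2 h3 h4
    refine ⟨by simp, ?_, ?_, ?_⟩ <;> simp
    · linear_combination -h2
    · linear_combination -h3
    · linear_combination -h4

/-- The term of second order of `leftTransformation φ A` on the line spanned by `v`. -/
noncomputable def leftTerm (φ : ℍ[ℝ] ≃ₗᵢ[ℝ] E4) (A : E4 →ₗ[ℝ] E4) (v : E4) : E4 :=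
  φ (φ.symm (A v) * φ.symm v)

section TakesTo

variable (φ : ℍ[ℝ] ≃ₗᵢ[ℝ] E4) (A : E4 →ₗ[ℝ] E4) {v n : E4}

/-- The circle with tangent vector `v` and second order term `A(v) v` consists of the points `y`
with real `v y⁻¹ + A(v)`; the value is the inverse of the parameter `t` for which `y` is the image
of `t v`. -/
theorem mem_circleThrough_iff (hv : v ≠ 0)
    (hn : ‖v‖ ^ 2 • n = ‖v‖ ^ 2 • leftTerm φ A v - ⟪leftTerm φ A v, v⟫ • v) {y : E4}
    (hy : y ≠ 0) :
    y ∈ circleThrough v n ↔ ∃ r : ℝ, φ.symm v * (φ.symm y)⁻¹ + φ.symm (A v) = r := by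
  have hx : φ.symm v ≠ 0 := by simpa using hv
  have hn' : φ.symm n = (φ.symm (A v) - ((φ.symm (A v)).re : ℍ[ℝ])) * φ.symm v := by
    have h := congrArg φ.symm hn
    rw [map_sub, map_smul, map_smul, map_smul, ← φ.symm.inner_map_map, leftTerm,
      φ.symm_apply_apply, ← φ.symm.norm_map v] at h
    generalize φ.symm v = x at *
    generalize φ.symm (A v) = a at *
    have h2 : ⟪a * x, x⟫ = ‖x‖ ^ 2 * a.re := by
      rw [Quaternion.inner_def, mul_assoc, Quaternion.self_mul_star,
        Quaternion.normSq_eq_norm_mul_self, sq, ← Quaternion.coe_commutes,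
        Quaternion.coe_mul_eq_smul, Quaternion.re_smul, smul_eq_mul]
    rw [h2, mul_smul, ← smul_sub] at h
    have h3 : ‖x‖ ^ 2 ≠ 0 := by simpa using hx
    rw [smul_right_injective _ h3 h, sub_mul, Quaternion.coe_mul_eq_smul]
  rw [← Quaternion.circle_equation_iff hx _ _ (by simpa using hy), ← hn']
  change ‖v‖ ^ 2 • y - ⟪y, v⟫ • v = ‖y‖ ^ 2 • n ↔ _
  rw [φ.symm.norm_map, φ.symm.norm_map, φ.symm.inner_map_map, ← map_smul, ← map_smul, ← map_smul,
    ← map_sub, φ.symm.injective.eq_iff]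

theorem mem_leftTransformation_smul {t : ℝ} {y : E4} :
    y ∈ leftTransformation φ A (t • v) ↔ t • φ.symm (A v) ≠ 1 ∧
      (1 - t • φ.symm (A v))⁻¹ * t • φ.symm v = φ.symm y := by
  have h : ∀ z, φ z = y ↔ z = φ.symm y := fun z => by
    rw [← φ.symm.injective.eq_iff, φ.symm_apply_apply]
  rw [← map_smul φ.symm, ← map_smul φ.symm, ← map_smul A, ← h]
  exact ⟨fun ⟨h1, h2⟩ => ⟨h1, h2⟩, fun ⟨h1, h2⟩ => ⟨h1, h2⟩⟩

theorem mem_circleThrough_of_mem_leftTransformation (hv : v ≠ 0)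
    (hn : ‖v‖ ^ 2 • n = ‖v‖ ^ 2 • leftTerm φ A v - ⟪leftTerm φ A v, v⟫ • v) {t : ℝ} {y : E4}
    (h : y ∈ leftTransformation φ A (t • v)) : y ∈ circleThrough v n := by
  rw [mem_leftTransformation_smul] at h
  obtain ⟨h1, h2⟩ := h
  by_cases hy : y = 0
  · simp [hy, circleThrough]
  rw [mem_circleThrough_iff φ A hv hn hy]
  have hx : φ.symm v ≠ 0 := by simpa using hv
  have ht : t ≠ 0 := by
    rintro rfl
    rw [zero_smul, zero_smul, mul_zero, eq_comm] at h2
    exact hy (by simpa using h2)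
  refine ⟨t⁻¹, ?_⟩
  rw [← h2, mul_inv_rev, inv_inv, ← mul_assoc, smul_inv₀, mul_smul_comm, mul_inv_cancel₀ hx,
    smul_mul_assoc, one_mul, smul_sub, smul_smul, inv_mul_cancel₀ ht, one_smul, sub_add_cancel]
  rw [← Quaternion.coe_mul_eq_smul, mul_one]

theorem mem_leftTransformation_of_eq (hv : v ≠ 0) {y : E4} (hy : y ≠ 0) {r : ℝ} (hr : r ≠ 0)
    (h : φ.symm v * (φ.symm y)⁻¹ + φ.symm (A v) = r) :
    y ∈ leftTransformation φ A (r⁻¹ • v) := by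
  rw [mem_leftTransformation_smul]
  have hx : φ.symm v ≠ 0 := by simpa using hv
  have hy' : φ.symm y ≠ 0 := by simpa using hy
  have h1 : φ.symm v * (φ.symm y)⁻¹ = (r : ℍ[ℝ]) - φ.symm (A v) := eq_sub_of_add_eq h
  have h2 : (1 : ℍ[ℝ]) - r⁻¹ • φ.symm (A v) = r⁻¹ • (φ.symm v * (φ.symm y)⁻¹) := by
    rw [h1, smul_sub, ← Quaternion.coe_mul_eq_smul r⁻¹ (r : ℍ[ℝ]), ← Quaternion.coe_mul,
      inv_mul_cancel₀ hr, Quaternion.coe_one]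
  refine ⟨fun h3 => ?_, ?_⟩
  · rw [h3, sub_self, eq_comm, smul_eq_zero] at h2
    exact h2.elim (inv_ne_zero hr) (mul_ne_zero hx (inv_ne_zero hy'))
  · rw [h2, smul_inv₀, inv_inv, mul_inv_rev, inv_inv, smul_mul_assoc, mul_smul_comm, smul_smul,
      mul_inv_cancel₀ hr, one_smul, inv_mul_cancel_right₀ hx]

theorem zero_mem_leftTransformation : (0 : E4) ∈ leftTransformation φ A 0 := by
  have := mem_leftTransformation_smul φ A (v := 0) (t := 0) (y := 0)
  rw [zero_smul] at this
  rw [this]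
  simp

/-- The point of the circle that corresponds to the point at infinity of the line is a limit of
points of the image. -/
theorem mem_closure_image_leftTransformation (hv : v ≠ 0) {y : E4} (hy : y ≠ 0)
    (h : φ.symm v * (φ.symm y)⁻¹ + φ.symm (A v) = 0) :
    y ∈ closure ((leftTransformation φ A).image (ℝ ∙ v)) := by
  have hx : φ.symm v ≠ 0 := by simpa using hv
  have hy' : φ.symm y ≠ 0 := by simpa using hy
  have ha : φ.symm (A v) = -(φ.symm v * (φ.symm y)⁻¹) := eq_neg_of_add_eq_zero_right h
  have ha0 : -φ.symm (A v) ≠ 0 := by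
    rw [ha, neg_neg]
    exact mul_ne_zero hx (inv_ne_zero hy')
  have hyval : (-φ.symm (A v))⁻¹ * φ.symm v = φ.symm y := by
    rw [ha, neg_neg, mul_inv_rev, inv_inv, inv_mul_cancel_right₀ hx]
  have hlim : Tendsto (fun r : ℝ => (r : ℍ[ℝ]) - φ.symm (A v)) (𝓝 0) (𝓝 (-φ.symm (A v))) := by
    have : Continuous fun r : ℝ => (r : ℍ[ℝ]) - φ.symm (A v) :=
      Quaternion.continuous_coe.sub continuous_const
    have h := this.tendsto 0
    rwa [Quaternion.coe_zero, zero_sub] at h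
  have hlim2 : Tendsto (fun r : ℝ => φ (((r : ℍ[ℝ]) - φ.symm (A v))⁻¹ * φ.symm v)) (𝓝[≠] 0)
      (𝓝 y) := by
    have h := φ.continuous.continuousAt.tendsto.comp
      ((hlim.inv₀ ha0).mul_const (φ.symm v))
    rw [hyval, φ.apply_symm_apply] at h
    exact h.mono_left nhdsWithin_le_nhds
  refine mem_closure_of_tendsto hlim2 ?_
  filter_upwards [self_mem_nhdsWithin, (hlim.eventually_ne ha0).filter_mono
    nhdsWithin_le_nhds] with r hr hr2
  have hz : φ (((r : ℍ[ℝ]) - φ.symm (A v))⁻¹ * φ.symm v) ≠ 0 := by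
    rw [ne_eq, map_eq_zero_iff φ φ.injective]
    exact mul_ne_zero (inv_ne_zero hr2) hx
  refine ⟨r⁻¹ • v, Submodule.smul_mem _ _ (Submodule.mem_span_singleton_self v),
    mem_leftTransformation_of_eq φ A hv hz hr ?_⟩
  rw [φ.symm_apply_apply, mul_inv_rev, inv_inv, mul_inv_cancel_left₀ hx, sub_add_cancel]

/-- If the second order term of `leftTransformation φ A` along the line spanned by `v` is, up to
a multiple of `v`, the curvature vector `n`, then the transformation takes this line to the circle
with tangent vector `v` and curvature vector `n`. -/
theorem takesTo_leftTransformation (hv : v ≠ 0)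
    (hn : ‖v‖ ^ 2 • n = ‖v‖ ^ 2 • leftTerm φ A v - ⟪leftTerm φ A v, v⟫ • v) :
    TakesTo (leftTransformation φ A) (ℝ ∙ v) (circleThrough v n) := by
  have hx : φ.symm v ≠ 0 := by simpa using hv
  have hsub : ∀ y ∈ (leftTransformation φ A).image (ℝ ∙ v), y ∈ circleThrough v n := by
    rintro y ⟨u, hu, hy⟩
    obtain ⟨t, rfl⟩ := Submodule.mem_span_singleton.1 hu
    exact mem_circleThrough_of_mem_leftTransformation φ A hv hn hy
  refine ⟨fun U hU => ?_, ?_⟩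
  · obtain ⟨δ, hδ, hball⟩ := Metric.mem_nhds_iff.1 hU
    have hnear : ∀ᶠ y : E4 in 𝓝 0, ‖y‖ * (‖v‖ / δ + ‖A v‖) < ‖v‖ := by
      have : Continuous fun y : E4 => ‖y‖ * (‖v‖ / δ + ‖A v‖) := by fun_prop
      refine this.tendsto 0 |>.eventually_lt_const ?_
      simpa using hv
    filter_upwards [hnear] with y hy
    constructor
    · rintro ⟨u, hu, huy⟩
      exact hsub y ⟨u, hu.1, huy⟩
    · intro hyc
      by_cases hy0 : y = 0
      · rw [hy0]
        exact ⟨0, ⟨Submodule.zero_mem _, mem_of_mem_nhds hU⟩, zero_mem_leftTransformation φ A⟩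
      obtain ⟨r, hr⟩ := (mem_circleThrough_iff φ A hv hn hy0).1 hyc
      have hypos : 0 < ‖y‖ := norm_pos_iff.2 hy0
      -- near the origin the parameter `r` is large
      have hbound : ‖v‖ / δ < |r| := by
        have h1 : ‖φ.symm v * (φ.symm y)⁻¹‖ ≤ |r| + ‖A v‖ := by
          rw [eq_sub_of_add_eq hr]
          refine (norm_sub_le _ _).trans ?_
          rw [φ.symm.norm_map, Quaternion.norm_coe, Real.norm_eq_abs]
        rw [norm_mul, norm_inv, φ.symm.norm_map, φ.symm.norm_map, ← div_eq_mul_inv] at h1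
        have h2 : ‖v‖ / δ + ‖A v‖ < ‖v‖ / ‖y‖ := by
          rw [lt_div_iff₀ hypos, mul_comm]
          exact hy
        linarith
      have hr0 : r ≠ 0 := by
        rintro rfl
        rw [abs_zero] at hbound
        exact absurd hbound (not_lt.2 (by positivity))
      refine ⟨r⁻¹ • v, ⟨Submodule.smul_mem _ _ (Submodule.mem_span_singleton_self v),
        hball ?_⟩, mem_leftTransformation_of_eq φ A hv hy0 hr0 hr⟩
      rw [mem_ball_zero_iff, norm_smul, norm_inv, Real.norm_eq_abs]
      rw [div_lt_iff₀ hδ] at hbound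
      rwa [inv_mul_lt_iff₀ (abs_pos.2 hr0)]
  · refine Set.Subset.antisymm (closure_minimal hsub (isClosed_circleThrough v n)) ?_
    intro y hyc
    by_cases hy0 : y = 0
    · rw [hy0]
      exact subset_closure ⟨0, Submodule.zero_mem _, zero_mem_leftTransformation φ A⟩
    obtain ⟨r, hr⟩ := (mem_circleThrough_iff φ A hv hn hy0).1 hyc
    by_cases hr0 : r = 0
    · rw [hr0, Quaternion.coe_zero] at hr
      exact mem_closure_image_leftTransformation φ A hv hy0 hr
    · exact subset_closure ⟨r⁻¹ • v, Submodule.smul_mem _ _ (Submodule.mem_span_singleton_self v),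
        mem_leftTransformation_of_eq φ A hv hy0 hr0 hr⟩

end TakesTo

/-- Quaternionic conjugation as a linear isometry. -/
noncomputable def quatConj : ℍ[ℝ] ≃ₗᵢ[ℝ] ℍ[ℝ] where
  toFun := star
  invFun := star
  left_inv := star_star
  right_inv := star_star
  map_add' := star_add
  map_smul' t x := by simp
  norm_map' := norm_star

/-- Conjugation exchanges left and right transformations. -/
theorem leftTransformation_quatConj_trans (φ : ℍ[ℝ] ≃ₗᵢ[ℝ] E4) (A : E4 →ₗ[ℝ] E4) :
    leftTransformation (quatConj.trans φ) A = rightTransformation φ A := by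
  funext x
  have hs : ∀ z, (quatConj.trans φ).symm z = star (φ.symm z) := fun z => rfl
  have ht : ∀ z, (quatConj.trans φ) z = φ (star z) := fun z => rfl
  refine Part.ext' ?_ ?_
  · change (quatConj.trans φ).symm (A x) ≠ 1 ↔ φ.symm (A x) ≠ 1
    rw [hs]
    exact not_congr ⟨fun h => by rw [← star_star (φ.symm (A x)), h, star_one],
      fun h => by rw [h, star_one]⟩
  · intro _ _
    change (quatConj.trans φ) ((1 - (quatConj.trans φ).symm (A x))⁻¹ *
      (quatConj.trans φ).symm x) = φ (φ.symm x * (1 - φ.symm (A x))⁻¹)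
    rw [hs, hs, ht, star_mul, star_star, star_inv₀, star_sub, star_star, star_one]

theorem rightTransformation_quatConj_trans (φ : ℍ[ℝ] ≃ₗᵢ[ℝ] E4) (A : E4 →ₗ[ℝ] E4) :
    rightTransformation (quatConj.trans φ) A = leftTransformation φ A := by
  rw [← leftTransformation_quatConj_trans]
  congr 1
  ext z
  simp [quatConj]

theorem mem_circleThrough {v n x : E4} :
    x ∈ circleThrough v n ↔ ‖v‖ ^ 2 • x - ⟪x, v⟫ • v = ‖x‖ ^ 2 • n := Iff.rfl

theorem circleThrough_zero_right {v : E4} (hv : v ≠ 0) : circleThrough v 0 = (ℝ ∙ v : Set E4) := by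
  have hv2 : ‖v‖ ^ 2 ≠ 0 := by simpa using hv
  ext x
  rw [mem_circleThrough, smul_zero, sub_eq_zero, SetLike.mem_coe, Submodule.mem_span_singleton]
  constructor
  · intro h
    refine ⟨(‖v‖ ^ 2)⁻¹ * ⟪x, v⟫, ?_⟩
    rw [mul_smul, ← h, inv_smul_smul₀ hv2]
  · rintro ⟨t, rfl⟩
    rw [real_inner_smul_left, real_inner_self_eq_norm_sq, smul_smul, mul_comm]

/-- The round circle with centre `o` through the origin; `v` spans the tangent line. -/
theorem circleThrough_eq_of_orthogonal {v o : E4} (hv : v ≠ 0) (ho : o ≠ 0) (hvo : ⟪v, o⟫ = 0) :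
    circleThrough v ((‖v‖ ^ 2 / (2 * ‖o‖ ^ 2)) • o)
      = {x | x ∈ Submodule.span ℝ {v, o} ∧ dist x o = ‖o‖} := by
  have hv2 : ‖v‖ ^ 2 ≠ 0 := by simpa using hv
  have ho2 : ‖o‖ ^ 2 ≠ 0 := by simpa using ho
  have hdist : ∀ x : E4, dist x o = ‖o‖ ↔ ‖x‖ ^ 2 = 2 * ⟪x, o⟫ := fun x => by
    rw [dist_eq_norm, ← sq_eq_sq₀ (norm_nonneg _) (norm_nonneg _), norm_sub_sq_real]
    constructor <;> intro h <;> linarith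
  ext x
  rw [mem_circleThrough, Set.mem_ofPred_eq, Submodule.mem_span_pair, hdist]
  constructor
  · intro h
    have hx : x = (⟪x, v⟫ / ‖v‖ ^ 2) • v + (‖x‖ ^ 2 / (2 * ‖o‖ ^ 2)) • o := by
      have h2 := congrArg ((‖v‖ ^ 2)⁻¹ • ·) (sub_eq_iff_eq_add.1 h)
      simp only [inv_smul_smul₀ hv2, smul_add, smul_smul] at h2
      have e1 : ⟪x, v⟫ / ‖v‖ ^ 2 = (‖v‖ ^ 2)⁻¹ * ⟪x, v⟫ := by rw [mul_comm, div_eq_mul_inv]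
      have e2 : ‖x‖ ^ 2 / (2 * ‖o‖ ^ 2)
          = (‖v‖ ^ 2)⁻¹ * (‖x‖ ^ 2 * (‖v‖ ^ 2 / (2 * ‖o‖ ^ 2))) := by field_simp
      rw [e1, e2, add_comm]
      exact h2
    refine ⟨⟨_, _, hx.symm⟩, ?_⟩
    have h3 := congrArg (fun z => ⟪z, o⟫) hx
    simp only [inner_add_left, real_inner_smul_left, hvo, real_inner_self_eq_norm_sq] at h3
    rw [h3]
    field_simp
    ring
  · rintro ⟨⟨α, β, rfl⟩, h⟩
    have hov : ⟪o, v⟫ = 0 := by rw [real_inner_comm]; exact hvo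
    rw [h]
    simp only [inner_add_left, real_inner_smul_left, hvo, hov, real_inner_self_eq_norm_sq]
    have : 2 * (α * 0 + β * ‖o‖ ^ 2) * (‖v‖ ^ 2 / (2 * ‖o‖ ^ 2)) = ‖v‖ ^ 2 * β := by
      field_simp
      ring
    rw [smul_smul, this]
    module

theorem IsCircle.exists_eq_circleThrough {c : Set E4} (hc : IsCircle c) (h0 : (0 : E4) ∈ c) :
    ∃ v n : E4, v ≠ 0 ∧ ⟪n, v⟫ = 0 ∧ c = circleThrough v n := by
  have hdir : ∀ P : AffineSubspace ℝ E4, (0 : E4) ∈ P → ∀ x, x ∈ P ↔ x ∈ P.direction :=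
    fun P hP x => by
      have := AffineSubspace.vsub_right_mem_direction_iff_mem hP x
      rwa [vsub_eq_sub, sub_zero, iff_comm] at this
  rcases hc with ⟨P, o, r, hP, hoP, hr, rfl⟩ | ⟨P, hP, rfl⟩
  · obtain ⟨h0P, h0r⟩ := h0
    rw [dist_zero_left] at h0r
    have ho : o ≠ 0 := norm_pos_iff.1 (h0r ▸ hr)
    have hod := (hdir P h0P o).1 hoP
    have hle : (ℝ ∙ o) ≤ P.direction := (Submodule.span_singleton_le_iff_mem _ _).2 hod
    have hrank := Submodule.finrank_add_inf_finrank_orthogonal hle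
    rw [hP, finrank_span_singleton ho] at hrank
    obtain ⟨v, hv⟩ : ∃ v : ((ℝ ∙ o)ᗮ ⊓ P.direction : Submodule ℝ E4), v ≠ 0 := by
      have := Module.finrank_pos_iff_exists_ne_zero
        (R := ℝ) (M := ((ℝ ∙ o)ᗮ ⊓ P.direction : Submodule ℝ E4))
      exact this.1 (by omega)
    have hv0 : (v : E4) ≠ 0 := fun h => hv (Subtype.ext h)
    have hov : ⟪o, (v : E4)⟫ = 0 := Submodule.mem_orthogonal_singleton_iff_inner_right.1 v.2.1
    have hvo : ⟪(v : E4), o⟫ = 0 := by rw [real_inner_comm]; exact hov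
    have hspan : Submodule.span ℝ {(v : E4), o} = P.direction := by
      refine Submodule.eq_of_le_of_finrank_eq ?_ ?_
      · rw [Submodule.span_le]
        rintro x (rfl | rfl)
        · exact v.2.2
        · exact hod
      · have hli : LinearIndependent ℝ ![(v : E4), o] := by
          rw [LinearIndependent.pair_iff]
          intro s t hst
          have h1 := congrArg (fun z => ⟪z, (v : E4)⟫) hst
          have h2 := congrArg (fun z => ⟪z, o⟫) hst
          simp only [inner_add_left, real_inner_smul_left, hov, hvo, inner_zero_left, mul_zero,
            add_zero, zero_add, mul_eq_zero, inner_self_eq_zero, hv0, ho, or_false] at h1 h2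
          exact ⟨h1, h2⟩
        have := finrank_span_eq_card hli
        rw [Matrix.range_cons, Matrix.range_cons, Matrix.range_empty, Set.union_empty,
          Set.singleton_union] at this
        rw [this, hP, Fintype.card_fin]
    refine ⟨v, (‖(v : E4)‖ ^ 2 / (2 * ‖o‖ ^ 2)) • o, hv0, ?_, ?_⟩
    · rw [real_inner_smul_left, hov, mul_zero]
    · rw [circleThrough_eq_of_orthogonal hv0 ho hvo, hspan, h0r]
      ext x
      exact and_congr_left' (hdir P h0P x)
  · obtain ⟨v, hv, hspan⟩ := finrank_eq_one_iff'.1 hP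
    have hv0 : (v : E4) ≠ 0 := fun h => hv (Subtype.ext h)
    refine ⟨v, 0, hv0, inner_zero_left _, ?_⟩
    rw [circleThrough_zero_right hv0]
    ext x
    rw [SetLike.mem_coe, SetLike.mem_coe, hdir P h0, Submodule.mem_span_singleton]
    constructor
    · intro hx
      obtain ⟨t, ht⟩ := hspan ⟨x, hx⟩
      exact ⟨t, congrArg Subtype.val ht⟩
    · rintro ⟨t, rfl⟩
      exact Submodule.smul_mem _ _ v.2

/-- An explicit arc of a circle through the origin. -/
theorem arc_mem_circleThrough {v n : E4} (hv : v ≠ 0) (hn : ⟪n, v⟫ = 0) (t : ℝ) :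
    (1 + t ^ 2 * (‖n‖ ^ 2 / ‖v‖ ^ 2))⁻¹ • (t • v + t ^ 2 • n) ∈ circleThrough v n := by
  have hv2 : ‖v‖ ^ 2 ≠ 0 := by simpa using hv
  have hpos : 1 + t ^ 2 * (‖n‖ ^ 2 / ‖v‖ ^ 2) ≠ 0 := by positivity
  have hvn : ⟪v, n⟫ = 0 := by rw [real_inner_comm]; exact hn
  have e1 : ‖t • v + t ^ 2 • n‖ ^ 2 = t ^ 2 * ‖v‖ ^ 2 + t ^ 4 * ‖n‖ ^ 2 := by
    rw [norm_add_sq_real, norm_smul, norm_smul, real_inner_smul_left, real_inner_smul_right, hvn,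
      mul_pow, mul_pow, Real.norm_eq_abs, Real.norm_eq_abs, sq_abs, sq_abs]
    ring
  rw [mem_circleThrough, norm_smul, mul_pow, e1, real_inner_smul_left, inner_add_left,
    real_inner_smul_left, real_inner_smul_left, hn, real_inner_self_eq_norm_sq, norm_inv, inv_pow,
    Real.norm_eq_abs, sq_abs]
  have e : ((1 + t ^ 2 * (‖n‖ ^ 2 / ‖v‖ ^ 2)) ^ 2)⁻¹ * (t ^ 2 * ‖v‖ ^ 2 + t ^ 4 * ‖n‖ ^ 2)
      = (1 + t ^ 2 * (‖n‖ ^ 2 / ‖v‖ ^ 2))⁻¹ * (t ^ 2 * ‖v‖ ^ 2) := by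
    field_simp
  rw [e]
  module

/-- The linear part at the origin of the equation of a circle through the origin. -/
theorem hasFDerivAt_circle_equation {E : Type*} [NormedAddCommGroup E] [InnerProductSpace ℝ E]
    (v n : E) :
    HasFDerivAt (fun x : E => ‖v‖ ^ 2 • x - ⟪x, v⟫ • v - ‖x‖ ^ 2 • n)
      (‖v‖ ^ 2 • ContinuousLinearMap.id ℝ E - (innerSL ℝ v).smulRight v) 0 := by
  have h2 := ((hasStrictFDerivAt_norm_sq (0 : E)).hasFDerivAt).smul_const n
  have h3 := (‖v‖ ^ 2 • ContinuousLinearMap.id ℝ E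
    - (innerSL ℝ v).smulRight v).hasFDerivAt (x := 0) |>.sub h2
  have e : (‖v‖ ^ 2 • ContinuousLinearMap.id ℝ E - (innerSL ℝ v).smulRight v)
      - (2 • innerSL ℝ (0 : E)).smulRight n
      = ‖v‖ ^ 2 • ContinuousLinearMap.id ℝ E - (innerSL ℝ v).smulRight v := by
    ext
    simp
  rw [e] at h3
  refine h3.congr_of_eventuallyEq (Eventually.of_forall fun x => ?_)
  simp [real_inner_comm]

theorem tangentConeAt_singleton_subset {E : Type*} [NormedAddCommGroup E] [NormedSpace ℝ E]
    (x : E) : tangentConeAt ℝ {x} x ⊆ {0} := by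
  refine tangentConeAt_subset_zero fun h => ?_
  obtain ⟨y, hy, hy'⟩ := (accPt_iff_frequently.1 h).exists
  exact hy hy'

theorem tangentLine_circleThrough {v n : E4} (hv : v ≠ 0) (hn : ⟪n, v⟫ = 0) :
    tangentLine (circleThrough v n) = (ℝ ∙ v : Set E4) := by
  have hv2 : ‖v‖ ^ 2 ≠ 0 := by simpa using hv
  apply Set.Subset.antisymm
  · -- the linear part of the equation of the circle vanishes on the tangent line
    intro y hy
    have hmaps := (hasFDerivAt_circle_equation v n).hasFDerivWithinAt.mapsTo_tangent_cone
      (s := circleThrough v n) hy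
    have himg : (fun x : E4 => ‖v‖ ^ 2 • x - ⟪x, v⟫ • v - ‖x‖ ^ 2 • n) '' circleThrough v n
        ⊆ {0} := by
      rintro _ ⟨x, hx, rfl⟩
      exact sub_eq_zero.2 hx
    have h0 := tangentConeAt_mono himg hmaps
    rw [inner_zero_left, norm_zero, zero_smul, smul_zero, sub_zero, zero_pow two_ne_zero,
      zero_smul, sub_zero] at h0
    have hLy := tangentConeAt_singleton_subset _ h0
    rw [← circleThrough_zero_right hv, mem_circleThrough, smul_zero]
    rw [Set.mem_singleton_iff] at hLy
    simpa [real_inner_comm] using hLy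
  · intro y hy
    obtain ⟨t, rfl⟩ := Submodule.mem_span_singleton.1 hy
    have hγ : HasDerivAt (fun s : ℝ => (1 + (s * t) ^ 2 * (‖n‖ ^ 2 / ‖v‖ ^ 2))⁻¹ •
        ((s * t) • v + (s * t) ^ 2 • n)) (t • v) 0 := by
      have h1 : HasDerivAt (fun s : ℝ => s * t) t 0 := by
        simpa using (hasDerivAt_id (0 : ℝ)).mul_const t
      have h2 : HasDerivAt (fun s : ℝ => (s * t) ^ 2) 0 0 := by
        have h := h1.mul h1
        simp only [zero_mul, mul_zero, add_zero] at h
        exact h.congr_of_eventuallyEq (Eventually.of_forall fun s => sq _)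
      have h3 := (((h2.mul_const (‖n‖ ^ 2 / ‖v‖ ^ 2)).const_add 1).inv (by simp)).smul
        ((h1.smul_const v).add (h2.smul_const n))
      exact (h3.congr_deriv (by simp)).congr_of_eventuallyEq (Eventually.of_forall fun s => rfl)
    have hmem := hγ.hasFDerivAt.hasFDerivWithinAt.mapsTo_tangent_cone (s := Set.univ)
      (show (1 : ℝ) ∈ tangentConeAt ℝ Set.univ 0 by simp)
    have himg : (fun s : ℝ => (1 + (s * t) ^ 2 * (‖n‖ ^ 2 / ‖v‖ ^ 2))⁻¹ •
        ((s * t) • v + (s * t) ^ 2 • n)) '' Set.univ ⊆ circleThrough v n := by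
      rintro _ ⟨s, -, rfl⟩
      exact arc_mem_circleThrough hv hn (s * t)
    have := tangentConeAt_mono himg hmem
    simpa [tangentLine] using this

/-! ### Taylor expansions of curves on circles -/

section Taylor

variable {E F : Type*} [NormedAddCommGroup E] [NormedSpace ℝ E] [NormedAddCommGroup F]
  [NormedSpace ℝ F]

/-- The Taylor term of degree `k` at the origin of a map given on the set `s`. -/
noncomputable def taylorTerm (f : E → F) (s : Set E) (k : ℕ) (v : E) : F :=
  ((k.factorial : ℝ)⁻¹) • iteratedFDerivWithin ℝ k f s 0 fun _ => v

/-- Taylor's formula with Peano remainder along a line through the origin. -/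
theorem isLittleO_sub_sum_taylorTerm {f : E → F} {s : Set E} {n : ℕ} (hs : IsOpen s)
    (hc : Convex ℝ s) (h0 : (0 : E) ∈ s) (hf : ContDiffOn ℝ n f s) (v : E) :
    (fun t : ℝ => f (t • v) - ∑ k ∈ Finset.range (n + 1), t ^ k • taylorTerm f s k v)
      =o[𝓝 0] fun t : ℝ => t ^ n := by
  let g : ℝ →L[ℝ] E := ContinuousLinearMap.toSpanSingleton ℝ v
  have hg0 : g 0 = 0 := map_zero g
  have hs' : IsOpen (g ⁻¹' s) := hs.preimage g.continuous
  have h0' : (0 : ℝ) ∈ g ⁻¹' s := by simpa [hg0] using h0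
  have hfg : ContDiffOn ℝ n (f ∘ g) (g ⁻¹' s) :=
    hf.comp g.contDiff.contDiffOn (Set.mapsTo_preimage _ _)
  have hc' : Convex ℝ (g ⁻¹' s) := hc.linear_preimage g.toLinearMap
  have h := taylor_isLittleO hc' h0' hfg
  rw [hs'.nhdsWithin_eq h0'] at h
  simp only [sub_zero] at h
  refine h.congr_left fun t => ?_
  rw [taylor_within_apply]
  congr 1
  refine Finset.sum_congr rfl fun k hk => ?_
  rw [iteratedDerivWithin_eq_iteratedFDerivWithin,
    g.iteratedFDerivWithin_comp_right hf hs.uniqueDiffOn hs'.uniqueDiffOn h0'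
      (by exact_mod_cast Nat.lt_succ_iff.1 (Finset.mem_range.1 hk)), hg0, taylorTerm, sub_zero,
    mul_comm, mul_smul]
  congr 2
  rw [ContinuousMultilinearMap.compContinuousLinearMap_apply]
  congr 1
  ext
  simp [g]

theorem taylorTerm_smul (f : E → F) (s : Set E) (k : ℕ) (t : ℝ) (v : E) :
    taylorTerm f s k (t • v) = t ^ k • taylorTerm f s k v := by
  rw [taylorTerm, ContinuousMultilinearMap.map_smul_univ, Finset.prod_const, Finset.card_univ,
    Fintype.card_fin, smul_comm, taylorTerm]

end Taylor

section Coefficients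

open Asymptotics

variable {E : Type*} [NormedAddCommGroup E] [InnerProductSpace ℝ E]

/-- Dividing an expansion by the variable. -/
theorem eq_zero_and_isLittleO_of_add_smul {e : E} {g : ℝ → E} {k : ℕ} (hg : ContinuousAt g 0)
    (h : (fun t : ℝ => e + t • g t) =o[𝓝[≠] 0] fun t : ℝ => t ^ (k + 1)) :
    e = 0 ∧ g =o[𝓝[≠] 0] fun t : ℝ => t ^ k := by
  have he : e = 0 := by
    have h1 : Tendsto (fun t : ℝ => e + t • g t) (𝓝[≠] 0) (𝓝 0) := by
      refine h.trans_tendsto ?_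
      have : Tendsto (fun t : ℝ => t ^ (k + 1)) (𝓝 0) (𝓝 (0 ^ (k + 1))) :=
        (continuous_pow (k + 1)).tendsto 0
      rw [zero_pow k.succ_ne_zero] at this
      exact this.mono_left nhdsWithin_le_nhds
    have h2 : Tendsto (fun t : ℝ => e + t • g t) (𝓝[≠] 0) (𝓝 (e + (0 : ℝ) • g 0)) :=
      (tendsto_const_nhds.add (tendsto_id.smul hg.tendsto)).mono_left nhdsWithin_le_nhds
    rw [zero_smul, add_zero] at h2
    exact tendsto_nhds_unique h2 h1
  refine ⟨he, ?_⟩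
  have h1 := (isBigO_refl (fun t : ℝ => t⁻¹) (𝓝[≠] 0)).smul_isLittleO h
  refine h1.congr' ?_ ?_
  · filter_upwards [self_mem_nhdsWithin] with t ht
    rw [he, zero_add, inv_smul_smul₀ ht]
  · filter_upwards [self_mem_nhdsWithin] with t ht
    rw [smul_eq_mul, pow_succ', inv_mul_cancel_left₀ ht]

/-- If the curve `t v + t² a + t³ b + t⁴ c + o(t⁴)` lies on the circle with tangent vector `v` and
curvature vector `n`, then the components of `a`, `b` and `c` orthogonal to `v` are determined by
`n` and the lower order coefficients. -/
theorem coefficients_of_curve_on_circle {v n a b c : E} {γ : ℝ → E}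
    (hγ : (fun t : ℝ => γ t - (t • v + t ^ 2 • a + t ^ 3 • b + t ^ 4 • c))
      =o[𝓝 0] fun t : ℝ => t ^ 4)
    (hc : ∀ᶠ t in 𝓝 0, ‖v‖ ^ 2 • γ t - ⟪γ t, v⟫ • v = ‖γ t‖ ^ 2 • n) :
    ‖v‖ ^ 2 • a - ⟪a, v⟫ • v = ‖v‖ ^ 2 • n ∧
      ‖v‖ ^ 2 • b - ⟪b, v⟫ • v = (2 * ⟪v, a⟫) • n ∧
      ‖v‖ ^ 2 • c - ⟪c, v⟫ • v = (‖a‖ ^ 2 + 2 * ⟪v, b⟫) • n := by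
  let p : ℝ → E := fun t => t • v + t ^ 2 • a + t ^ 3 • b + t ^ 4 • c
  -- `π` is a multiple of the orthogonal projection along `v`
  let π : E →L[ℝ] E := ‖v‖ ^ 2 • ContinuousLinearMap.id ℝ E - (innerSL ℝ v).smulRight v
  have hπ : ∀ x, π x = ‖v‖ ^ 2 • x - ⟪x, v⟫ • v := fun x => by simp [π, real_inner_comm]
  have hπv : π v = 0 := by rw [hπ, real_inner_self_eq_norm_sq, sub_self]
  have hp : p =O[𝓝 0] fun _ : ℝ => (1 : ℝ) := by
    have : ContinuousAt p 0 := by fun_prop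
    exact this.tendsto.isBigO_one ℝ
  have ht4 : (fun t : ℝ => t ^ 4) =O[𝓝 0] fun _ : ℝ => (1 : ℝ) := by
    have : ContinuousAt (fun t : ℝ => t ^ 4) 0 := by fun_prop
    exact this.tendsto.isBigO_one ℝ
  -- the remainder does not affect the equation of the circle up to order four
  have hrem : (fun t => π (p t) - ‖p t‖ ^ 2 • n) =o[𝓝 0] fun t : ℝ => t ^ 4 := by
    have h1 : (fun t => π (γ t - p t)) =o[𝓝 0] fun t : ℝ => t ^ 4 :=
      (π.isBigO_comp _ _).trans_isLittleO hγ
    have h2 : (fun t => (⟪γ t - p t, p t + p t + (γ t - p t)⟫ : ℝ)) =o[𝓝 0]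
        fun t : ℝ => t ^ 4 := by
      have hb : (fun t => p t + p t + (γ t - p t)) =O[𝓝 0] fun _ : ℝ => (1 : ℝ) :=
        (hp.add hp).add (hγ.isBigO.trans ht4)
      have h3 : (fun t => (⟪γ t - p t, p t + p t + (γ t - p t)⟫ : ℝ)) =O[𝓝 0]
          fun t => ‖γ t - p t‖ * ‖p t + p t + (γ t - p t)‖ :=
        IsBigO.of_bound 1 (Eventually.of_forall fun t => by
          rw [one_mul, Real.norm_eq_abs, Real.norm_eq_abs]
          exact (abs_real_inner_le_norm _ _).trans (le_abs_self _))
      refine h3.trans_isLittleO ?_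
      simpa using hγ.norm_left.mul_isBigO hb.norm_left
    have h4 : (fun t => π (γ t - p t) - (⟪γ t - p t, p t + p t + (γ t - p t)⟫ : ℝ) • n)
        =o[𝓝 0] fun t : ℝ => t ^ 4 := by
      refine h1.sub ?_
      have := h2.smul_isBigO (isBigO_const_const n (one_ne_zero (α := ℝ)) (𝓝 (0 : ℝ)))
      simpa using this
    refine h4.neg_left.congr' ?_ EventuallyEq.rfl
    filter_upwards [hc] with t ht
    have h5 : (⟪γ t - p t, p t + p t + (γ t - p t)⟫ : ℝ) = ‖γ t‖ ^ 2 - ‖p t‖ ^ 2 := by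
      rw [← real_inner_self_eq_norm_sq, ← real_inner_self_eq_norm_sq]
      simp only [inner_add_right, inner_sub_left, inner_sub_right, real_inner_comm (p t) (γ t)]
      ring
    rw [h5, map_sub, hπ (γ t), ht, sub_smul]
    abel
  let w : ℝ → E := fun t => -((2 * ⟪v, c⟫ + 2 * ⟪a, b⟫ + t * (‖b‖ ^ 2 + 2 * ⟪a, c⟫)
    + t ^ 2 * (2 * ⟪b, c⟫) + t ^ 3 * ‖c‖ ^ 2) • n)
  have hexp : ∀ t, π (p t) - ‖p t‖ ^ 2 • n = 0 + t • ((0 : E) + t • ((π a - ‖v‖ ^ 2 • n)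
      + t • ((π b - (2 * ⟪v, a⟫) • n) + t • ((π c - (‖a‖ ^ 2 + 2 * ⟪v, b⟫) • n) + t • w t)))) := by
    intro t
    have hnorm : ‖p t‖ ^ 2 = t ^ 2 * ‖v‖ ^ 2 + t ^ 3 * (2 * ⟪v, a⟫)
        + t ^ 4 * (‖a‖ ^ 2 + 2 * ⟪v, b⟫) + t ^ 5 * (2 * ⟪v, c⟫ + 2 * ⟪a, b⟫
        + t * (‖b‖ ^ 2 + 2 * ⟪a, c⟫) + t ^ 2 * (2 * ⟪b, c⟫) + t ^ 3 * ‖c‖ ^ 2) := by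
      simp only [p, ← real_inner_self_eq_norm_sq, inner_add_left, inner_add_right,
        real_inner_smul_left, real_inner_smul_right, real_inner_comm v a, real_inner_comm v b,
        real_inner_comm v c, real_inner_comm a b, real_inner_comm a c, real_inner_comm b c]
      ring
    rw [hnorm]
    simp only [p, map_add, map_smul, hπv, w]
    module
  simp only [hexp] at hrem
  have hw : Continuous w := by fun_prop
  obtain ⟨-, h⟩ := eq_zero_and_isLittleO_of_add_smul (k := 3) (by fun_prop)
    (hrem.mono nhdsWithin_le_nhds)
  obtain ⟨-, h⟩ := eq_zero_and_isLittleO_of_add_smul (k := 2) (by fun_prop) h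
  obtain ⟨e2, h⟩ := eq_zero_and_isLittleO_of_add_smul (k := 1) (by fun_prop) h
  obtain ⟨e3, h⟩ := eq_zero_and_isLittleO_of_add_smul (k := 0) (by fun_prop) h
  have e4 : π c - (‖a‖ ^ 2 + 2 * ⟪v, b⟫) • n = 0 := by
    have h1 : Tendsto (fun t : ℝ => π c - (‖a‖ ^ 2 + 2 * ⟪v, b⟫) • n + t • w t) (𝓝[≠] 0)
        (𝓝 0) := by
      simpa using h
    have h2 : ContinuousAt (fun t : ℝ => π c - (‖a‖ ^ 2 + 2 * ⟪v, b⟫) • n + t • w t) 0 := by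
      fun_prop
    have h3 := tendsto_nhds_unique (h2.tendsto.mono_left nhdsWithin_le_nhds) h1
    rwa [zero_smul, add_zero] at h3
  rw [hπ, sub_eq_zero] at e2 e3 e4
  exact ⟨e2, e3, e4⟩

end Coefficients

/-! ### Normalised rectifications -/

/-- A rectifiable bundle of circles is the image of the bundle of their tangent lines under the
germ of a smooth map `Ψ` with linear part the identity. -/
theorem IsRectifiable.exists_normalised {S : Set (Set E4)} (hS : ∀ c ∈ S, (0 : E4) ∈ c)
    (h : IsRectifiable S) :
    ∃ (Ψ : E4 → E4) (s : Set E4), IsOpen s ∧ Convex ℝ s ∧ (0 : E4) ∈ s ∧ ContDiffOn ℝ ∞ Ψ s ∧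
      Ψ 0 = 0 ∧ HasFDerivAt Ψ (ContinuousLinearMap.id ℝ E4) 0 ∧
      ∀ c ∈ S, ∀ v : E4, tangentLine c = (ℝ ∙ v : Set E4) → ∀ᶠ t : ℝ in 𝓝 0, Ψ (t • v) ∈ c := by
  obtain ⟨f, hf0, hf, hg, hL⟩ := h
  set p := f 0 with hp
  have hpt : p ∈ f.target := f.map_source hf0
  have hgp : f.symm p = 0 := f.left_inv hf0
  have hfd : HasFDerivAt f (fderiv ℝ f 0) 0 :=
    ((hf.contDiffAt (f.open_source.mem_nhds hf0)).differentiableAt (by simp)).hasFDerivAt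
  have hgd : HasFDerivAt f.symm (fderiv ℝ f.symm p) p :=
    ((hg.contDiffAt (f.open_target.mem_nhds hpt)).differentiableAt (by simp)).hasFDerivAt
  generalize fderiv ℝ f 0 = N at hfd
  generalize fderiv ℝ f.symm p = M at hgd
  have hMN : M.comp N = ContinuousLinearMap.id ℝ E4 := by
    have h1 : HasFDerivAt (f.symm ∘ f) (M.comp N) 0 := hgd.comp 0 hfd
    refine h1.unique ((hasFDerivAt_id (0 : E4)).congr_of_eventuallyEq ?_)
    filter_upwards [f.open_source.mem_nhds hf0] with x hx
    exact f.left_inv hx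
  have hNM : N.comp M = ContinuousLinearMap.id ℝ E4 := by
    have h1 : HasFDerivAt (f ∘ f.symm) (N.comp M) p := by
      rw [← hgp] at hfd
      exact hfd.comp p hgd
    refine h1.unique ((hasFDerivAt_id p).congr_of_eventuallyEq ?_)
    filter_upwards [f.open_target.mem_nhds hpt] with x hx
    exact f.right_inv hx
  have haff : ContDiff ℝ ∞ fun x : E4 => p + N x := contDiff_const.add N.contDiff
  have hnhds : (fun x : E4 => p + N x) ⁻¹' f.target ∈ 𝓝 (0 : E4) := by
    refine (f.open_target.preimage haff.continuous).mem_nhds ?_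
    simpa using hpt
  obtain ⟨r, hr, hball⟩ := Metric.mem_nhds_iff.1 hnhds
  have hderiv : HasFDerivAt (fun x => f.symm (p + N x)) (ContinuousLinearMap.id ℝ E4) 0 := by
    have h1 : HasFDerivAt (fun x : E4 => p + N x) N 0 := N.hasFDerivAt.const_add p
    have h2 : HasFDerivAt f.symm M (p + N 0) := by rwa [map_zero, add_zero]
    rw [← hMN]
    exact h2.comp 0 h1
  refine ⟨fun x => f.symm (p + N x), Metric.ball 0 r, Metric.isOpen_ball, convex_ball 0 r,
    Metric.mem_ball_self hr, hg.comp haff.contDiffOn hball, ?_, hderiv, ?_⟩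
  · simp [hgp]
  intro c hc v hv
  obtain ⟨L, ⟨P, hP, rfl⟩, hcL⟩ := hL c hc
  have hpP : p ∈ P := hcL.self_of_nhds.1 (hS c hc)
  obtain ⟨u, hu, hspan⟩ := finrank_eq_one_iff'.1 hP
  have hmem : ∀ t : ℝ, p + t • (u : E4) ∈ P := fun t => by
    rw [add_comm]
    exact AffineSubspace.vadd_mem_of_mem_direction (P.direction.smul_mem t u.2) hpP
  -- a parametrisation of the germ of the curve by the line that rectifies it
  have hcurve : ∀ᶠ t : ℝ in 𝓝 0, f.symm (p + t • (u : E4)) ∈ c := by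
    have hcont : ContinuousAt (fun t : ℝ => p + t • (u : E4)) 0 := by fun_prop
    have h1 : Tendsto (fun t : ℝ => p + t • (u : E4)) (𝓝 0) (𝓝 p) := by
      simpa using hcont.tendsto
    have h2 : Tendsto (fun t : ℝ => f.symm (p + t • (u : E4))) (𝓝 0) (𝓝 0) := by
      have := hgd.continuousAt.tendsto.comp h1
      rwa [hgp] at this
    filter_upwards [h2.eventually hcL, h1.eventually (f.open_target.mem_nhds hpt)] with t h3 h4
    rw [h3, f.right_inv h4]
    exact hmem t
  have htan : M u ∈ tangentLine c := by
    have h1 : HasDerivAt (fun t : ℝ => f.symm (p + t • (u : E4))) (M u) 0 := by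
      have h2 : HasDerivAt (fun t : ℝ => p + t • (u : E4)) (u : E4) 0 := by
        simpa using ((hasDerivAt_id (0 : ℝ)).smul_const (u : E4)).const_add p
      have h3 : HasFDerivAt f.symm M (p + (0 : ℝ) • (u : E4)) := by
        rwa [zero_smul, add_zero]
      exact h3.comp_hasDerivAt 0 h2
    have h4 := h1.hasFDerivAt.hasFDerivWithinAt.mapsTo_tangent_cone
      (s := {t : ℝ | f.symm (p + t • (u : E4)) ∈ c})
      (show (1 : ℝ) ∈ tangentConeAt ℝ _ 0 by
        rw [tangentConeAt_of_mem_nhds hcurve]; trivial)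
    have h5 := tangentConeAt_mono (t := c) (by rintro _ ⟨t, ht, rfl⟩; exact ht) h4
    simpa [tangentLine, hgp] using h5
  rw [hv] at htan
  obtain ⟨κ, hκ⟩ := Submodule.mem_span_singleton.1 htan
  have hNu : κ • N v = u := by
    rw [← map_smul, hκ]
    exact congrArg (fun A : E4 →L[ℝ] E4 => A u) hNM
  have hκ0 : κ ≠ 0 := by
    rintro rfl
    rw [zero_smul] at hNu
    exact hu (Subtype.ext hNu.symm)
  have hlim : Tendsto (fun t : ℝ => t * κ⁻¹) (𝓝 0) (𝓝 0) := by
    have : Continuous fun t : ℝ => t * κ⁻¹ := by fun_prop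
    simpa using this.tendsto 0
  filter_upwards [hlim.eventually hcurve] with t ht
  rwa [← hNu, smul_smul, inv_mul_cancel_right₀ hκ0, ← map_smul] at ht

/-! ### The circle conditions as polynomial identities -/

namespace IsPolyFun

variable {n d e : ℕ} {f g : (Fin n → ℝ) → ℝ}

theorem mono (hf : IsPolyFun d f) (h : d ≤ e) : IsPolyFun e f := by
  obtain ⟨p, hp, hpf⟩ := hf
  exact ⟨p, hp.trans h, hpf⟩

theorem const (c : ℝ) : IsPolyFun (n := n) d fun _ => c :=
  ⟨MvPolynomial.C c, by simp, fun x => by simp⟩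

theorem coord (i : Fin n) : IsPolyFun 1 fun x : Fin n → ℝ => x i :=
  ⟨MvPolynomial.X i, (MvPolynomial.totalDegree_X i).le, fun x => by simp⟩

theorem add (hf : IsPolyFun d f) (hg : IsPolyFun d g) : IsPolyFun d fun x => f x + g x := by
  obtain ⟨p, hp, hpf⟩ := hf
  obtain ⟨q, hq, hqg⟩ := hg
  exact ⟨p + q, (MvPolynomial.totalDegree_add p q).trans (max_le hp hq), fun x => by
    rw [map_add, hpf, hqg]⟩

theorem mul (hf : IsPolyFun d f) (hg : IsPolyFun e g) :
    IsPolyFun (d + e) fun x => f x * g x := by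
  obtain ⟨p, hp, hpf⟩ := hf
  obtain ⟨q, hq, hqg⟩ := hg
  exact ⟨p * q, (MvPolynomial.totalDegree_mul p q).trans (add_le_add hp hq), fun x => by
    rw [map_mul, hpf, hqg]⟩

theorem const_mul (c : ℝ) (hf : IsPolyFun d f) : IsPolyFun d fun x => c * f x := by
  simpa using (IsPolyFun.const (d := 0) c).mul hf

theorem sub (hf : IsPolyFun d f) (hg : IsPolyFun d g) : IsPolyFun d fun x => f x - g x := by
  simpa [sub_eq_add_neg] using hf.add (hg.const_mul (-1))

theorem sum {ι : Type*} (s : Finset ι) {f : ι → (Fin n → ℝ) → ℝ}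
    (hf : ∀ i ∈ s, IsPolyFun d (f i)) : IsPolyFun d fun x => ∑ i ∈ s, f i x := by
  classical
  induction s using Finset.induction_on with
  | empty => simpa using IsPolyFun.const (n := n) (d := d) 0
  | insert i s hi ih =>
    simp only [Finset.sum_insert hi]
    exact (hf i (Finset.mem_insert_self i s)).add
      (ih fun j hj => hf j (Finset.mem_insert_of_mem hj))

theorem prod_coord {k : ℕ} (r : Fin k → Fin n) :
    IsPolyFun k fun x : Fin n → ℝ => ∏ j, x (r j) := by
  refine ⟨∏ j, MvPolynomial.X (r j), ?_, fun x => by simp⟩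
  refine (MvPolynomial.totalDegree_finsetProd _ _).trans ?_
  simp

theorem dotProduct {F G : (Fin n → ℝ) → Fin n → ℝ} (hF : ∀ i, IsPolyFun d fun x => F x i)
    (hG : ∀ i, IsPolyFun e fun x => G x i) : IsPolyFun (d + e) fun x => F x ⬝ᵥ G x :=
  IsPolyFun.sum _ fun i _ => (hF i).mul (hG i)

/-- A multilinear form on the diagonal is a polynomial. -/
theorem multilinear {k : ℕ} {V : Type*} [AddCommGroup V] [Module ℝ V]
    (M : MultilinearMap ℝ (fun _ : Fin k => V) ℝ) (L : (Fin n → ℝ) →ₗ[ℝ] V) :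
    IsPolyFun k fun x => M fun _ => L x := by
  classical
  have h : ∀ x, (M fun _ => L x)
      = ∑ r : Fin k → Fin n, (M fun j => L (Pi.single (r j) 1)) * ∏ j, x (r j) := by
    intro x
    have hx : L x = ∑ i, x i • L (Pi.single i 1) := by
      conv_lhs => rw [pi_eq_sum_univ' x, map_sum]
      exact Finset.sum_congr rfl fun i _ => map_smul L _ _
    simp only [hx]
    rw [M.map_sum]
    refine Finset.sum_congr rfl fun r _ => ?_
    rw [M.map_smul_univ, smul_eq_mul, mul_comm]
  simp only [h]
  exact IsPolyFun.sum _ fun r _ => (prod_coord r).const_mul _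

end IsPolyFun

section CircleConditions

variable {E : Type*} [NormedAddCommGroup E] [InnerProductSpace ℝ E]

/-- The conditions on the coefficients of a curve `t v + t² a + t³ b + t⁴ c + …` that it meets a
circle through the origin up to order four. -/
def CircleConditions (v a b c : E) : Prop :=
  ‖v‖ ^ 2 • (‖v‖ ^ 2 • b - ⟪b, v⟫ • v) = (2 * ⟪v, a⟫) • (‖v‖ ^ 2 • a - ⟪a, v⟫ • v) ∧
    ‖v‖ ^ 2 • (‖v‖ ^ 2 • c - ⟪c, v⟫ • v)
      = (‖a‖ ^ 2 + 2 * ⟪v, b⟫) • (‖v‖ ^ 2 • a - ⟪a, v⟫ • v)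

theorem CircleConditions.map {F : Type*} [NormedAddCommGroup F] [InnerProductSpace ℝ F]
    (g : E ≃ₗᵢ[ℝ] F) {v a b c : E} (h : CircleConditions v a b c) :
    CircleConditions (g v) (g a) (g b) (g c) := by
  obtain ⟨h3, h4⟩ := h
  constructor
  · simp only [g.norm_map, g.inner_map_map, ← map_smul, ← map_sub, h3]
  · simp only [g.norm_map, g.inner_map_map, ← map_smul, ← map_sub, h4]

end CircleConditions

theorem EuclideanSpace.inner_eq_dotProduct {n : ℕ} (x y : EuclideanSpace ℝ (Fin n)) :
    (⟪x, y⟫ : ℝ) = x.ofLp ⬝ᵥ y.ofLp := by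
  simp [PiLp.inner_apply, dotProduct, mul_comm]

theorem circleConditions_iff_coord {x : Fin 4 → ℝ} {a b c : E4} :
    CircleConditions (WithLp.toLp 2 x) a b c ↔
      (∀ i, (x ⬝ᵥ x) * ((x ⬝ᵥ x) * b i - (b.ofLp ⬝ᵥ x) * x i)
        - 2 * (x ⬝ᵥ a.ofLp) * ((x ⬝ᵥ x) * a i - (a.ofLp ⬝ᵥ x) * x i) = 0) ∧
      ∀ i, (x ⬝ᵥ x) * ((x ⬝ᵥ x) * c i - (c.ofLp ⬝ᵥ x) * x i)
        - (a.ofLp ⬝ᵥ a.ofLp + 2 * (x ⬝ᵥ b.ofLp)) * ((x ⬝ᵥ x) * a i - (a.ofLp ⬝ᵥ x) * x i) = 0 := by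
  simp only [CircleConditions, ← real_inner_self_eq_norm_sq, EuclideanSpace.inner_eq_dotProduct,
    PiLp.ext_iff, sub_eq_zero, PiLp.smul_apply, PiLp.sub_apply, smul_eq_mul]

/-- Polynomial curve coefficients that satisfy the circle conditions at points in general
position satisfy them everywhere. -/
theorem circleConditions_of_generalPosition {N : ℕ} {v : Fin N → Fin 4 → ℝ}
    (hv : ∀ p : MvPolynomial (Fin 4) ℝ, p.totalDegree ≤ 8 →
      (∀ i, MvPolynomial.eval (v i) p = 0) → p = 0)
    {a b c : (Fin 4 → ℝ) → E4} (ha : ∀ i, IsPolyFun 2 fun x => a x i)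
    (hb : ∀ i, IsPolyFun 3 fun x => b x i) (hc : ∀ i, IsPolyFun 4 fun x => c x i)
    (h : ∀ j, CircleConditions (WithLp.toLp 2 (v j)) (a (v j)) (b (v j)) (c (v j)))
    (x : Fin 4 → ℝ) : CircleConditions (WithLp.toLp 2 x) (a x) (b x) (c x) := by
  have hzero : ∀ f : (Fin 4 → ℝ) → ℝ, IsPolyFun 8 f → (∀ j, f (v j) = 0) → f x = 0 := by
    rintro f ⟨p, hp, hpf⟩ h0
    rw [← hpf, hv p hp (fun j => (hpf _).trans (h0 j)), map_zero]
  simp only [circleConditions_iff_coord] at h ⊢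
  have hx := IsPolyFun.coord (n := 4)
  have hxx := IsPolyFun.dotProduct hx hx
  have hπ : ∀ {d : ℕ} {F : (Fin 4 → ℝ) → E4}, (∀ i, IsPolyFun d fun x => F x i) → ∀ i,
      IsPolyFun (d + 2) fun x => (x ⬝ᵥ x) * F x i - ((F x).ofLp ⬝ᵥ x) * x i := fun hF i =>
    ((hxx.mul (hF i)).mono (by omega)).sub (((IsPolyFun.dotProduct hF hx).mul (hx i)).mono
      (by omega))
  refine ⟨fun i => ?_, fun i => ?_⟩
  · refine hzero _ (((hxx.mul (hπ hb i)).mono (by omega)).sub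
      (((((IsPolyFun.dotProduct hx ha).const_mul 2)).mul (hπ ha i)).mono (by omega)))
      fun j => (h j).1 i
  · refine hzero _ (((hxx.mul (hπ hc i)).mono (by omega)).sub
      ((((IsPolyFun.dotProduct ha ha).add (((IsPolyFun.dotProduct hx hb).const_mul 2).mono
        (by omega))).mul (hπ ha i)).mono (by omega)))
      fun j => (h j).2 i

theorem isPolyFun_taylorTerm (Ψ : E4 → E4) (s : Set E4) (k : ℕ) (g : E4 ≃ₗᵢ[ℝ] E4) (i : Fin 4) :
    IsPolyFun k fun x : Fin 4 → ℝ => g.symm (taylorTerm Ψ s k (g (WithLp.toLp 2 x))) i := by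
  let l : E4 →ₗ[ℝ] ℝ := (EuclideanSpace.proj i).toLinearMap ∘ₗ g.symm.toLinearEquiv.toLinearMap
  have := (IsPolyFun.multilinear (l.compMultilinearMap
    (iteratedFDerivWithin ℝ k Ψ s 0).toMultilinearMap)
    (g.toLinearEquiv.toLinearMap ∘ₗ (WithLp.linearEquiv 2 ℝ (Fin 4 → ℝ)).symm.toLinearMap)).const_mul
      (k.factorial : ℝ)⁻¹
  convert this using 2 with x
  simp [taylorTerm, l]

/-! ### The classification of rectifiable bundles -/

theorem circleThrough_smul (v n : E4) {κ : ℝ} (hκ : κ ≠ 0) :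
    circleThrough (κ • v) (κ ^ 2 • n) = circleThrough v n := by
  ext x
  rw [mem_circleThrough, mem_circleThrough, norm_smul, Real.norm_eq_abs, mul_pow, sq_abs,
    real_inner_smul_right]
  have e1 : (κ ^ 2 * ‖v‖ ^ 2) • x - (κ * ⟪x, v⟫) • κ • v
      = κ ^ 2 • (‖v‖ ^ 2 • x - ⟪x, v⟫ • v) := by module
  have e2 : ‖x‖ ^ 2 • κ ^ 2 • n = κ ^ 2 • ‖x‖ ^ 2 • n := by module
  rw [e1, e2]
  exact (smul_right_injective E4 (pow_ne_zero 2 hκ)).eq_iff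

/-- A circle through the origin in terms of any of its tangent vectors. -/
theorem IsCircle.exists_eq_circleThrough_of_mem_tangentLine {c : Set E4} (hc : IsCircle c)
    (h0 : (0 : E4) ∈ c) {u : E4} (hu : u ∈ tangentLine c) (hu0 : u ≠ 0) :
    ∃ n : E4, ⟪n, u⟫ = 0 ∧ c = circleThrough u n := by
  obtain ⟨v, n, hv, hn, rfl⟩ := hc.exists_eq_circleThrough h0
  rw [tangentLine_circleThrough hv hn] at hu
  obtain ⟨κ, rfl⟩ := Submodule.mem_span_singleton.1 hu
  have hκ : κ ≠ 0 := by
    rintro rfl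
    exact hu0 (zero_smul _ _)
  refine ⟨κ ^ 2 • n, ?_, (circleThrough_smul v n hκ).symm⟩
  rw [real_inner_smul_left, real_inner_smul_right, hn, mul_zero, mul_zero]

/-- The Taylor terms of a normalised map that takes the line spanned by `v` to a circle. -/
theorem circleConditions_taylorTerm {Ψ : E4 → E4} {s : Set E4} (hs : IsOpen s)
    (hconv : Convex ℝ s) (h0 : (0 : E4) ∈ s) (hΨ : ContDiffOn ℝ ∞ Ψ s) (hΨ0 : Ψ 0 = 0)
    (hΨ1 : HasFDerivAt Ψ (ContinuousLinearMap.id ℝ E4) 0) {v n : E4}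
    (h : ∀ᶠ t : ℝ in 𝓝 0, Ψ (t • v) ∈ circleThrough v n) :
    ‖v‖ ^ 2 • n = ‖v‖ ^ 2 • taylorTerm Ψ s 2 v - ⟪taylorTerm Ψ s 2 v, v⟫ • v ∧
      CircleConditions v (taylorTerm Ψ s 2 v) (taylorTerm Ψ s 3 v) (taylorTerm Ψ s 4 v) := by
  have ht := isLittleO_sub_sum_taylorTerm (n := 4) hs hconv h0 (contDiffOn_infty.1 hΨ 4) v
  have t0 : taylorTerm Ψ s 0 v = 0 := by
    simp [taylorTerm, hΨ0]
  have t1 : taylorTerm Ψ s 1 v = v := by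
    rw [taylorTerm, iteratedFDerivWithin_one_apply (hs.uniqueDiffWithinAt h0),
      fderivWithin_of_isOpen hs h0, hΨ1.fderiv]
    simp
  simp only [Finset.sum_range_succ, Finset.sum_range_zero, t0, t1, smul_zero, zero_add,
    pow_one] at ht
  obtain ⟨e2, e3, e4⟩ := coefficients_of_curve_on_circle ht h
  refine ⟨e2.symm, ?_, ?_⟩
  · rw [e3, e2, smul_comm]
  · rw [e4, e2, smul_comm]

/-- A quadratic map of the kind classified by `exists_linear_of_circle_conditions` is the second
order term of a left or of a right transformation. -/
theorem exists_leftTerm_eq (φ : ℍ[ℝ] ≃ₗᵢ[ℝ] E4) {Ψ : E4 → E4} {s : Set E4}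
    (h : ∀ v, CircleConditions v (taylorTerm Ψ s 2 v) (taylorTerm Ψ s 3 v) (taylorTerm Ψ s 4 v)) :
    (∃ A : E4 →ₗ[ℝ] E4, ∀ v, leftTerm φ A v = taylorTerm Ψ s 2 v) ∨
      ∃ A : E4 →ₗ[ℝ] E4, ∀ v, leftTerm (quatConj.trans φ) A v = taylorTerm Ψ s 2 v := by
  let g : E4 ≃ₗᵢ[ℝ] E4 := Quaternion.linearIsometryEquivTuple.symm.trans φ
  have hg : ∀ x : Fin 4 → ℝ, g (WithLp.toLp 2 x) = φ (quatOf x) := fun x => rfl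
  have hgs : ∀ v : E4, quatOf (g.symm v).ofLp = φ.symm v := fun v => by
    rw [← φ.injective.eq_iff, ← hg, WithLp.toLp_ofLp, g.apply_symm_apply, φ.apply_symm_apply]
  let T : ℕ → (Fin 4 → ℝ) → Fin 4 → ℝ := fun k x =>
    (g.symm (taylorTerm Ψ s k (g (WithLp.toLp 2 x)))).ofLp
  have hT : ∀ k i, IsPolyFun k fun x => T k x i := fun k i => isPolyFun_taylorTerm Ψ s k g i
  have hcond : ∀ x : Fin 4 → ℝ, CircleConditions (WithLp.toLp 2 x) (WithLp.toLp 2 (T 2 x))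
      (WithLp.toLp 2 (T 3 x)) (WithLp.toLp 2 (T 4 x)) := fun x => by
    have := (h (g (WithLp.toLp 2 x))).map g.symm
    rwa [g.symm_apply_apply] at this
  simp only [circleConditions_iff_coord] at hcond
  have hT2 : ∀ v : E4, quatOf (T 2 (g.symm v).ofLp) = φ.symm (taylorTerm Ψ s 2 v) := fun v => by
    simp only [T]
    rw [WithLp.toLp_ofLp, g.apply_symm_apply, hgs]
  have hA : ∀ (A : (Fin 4 → ℝ) →ₗ[ℝ] Fin 4 → ℝ), ∃ B : E4 →ₗ[ℝ] E4, ∀ v,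
      φ.symm (B v) = quatOf (A (g.symm v).ofLp) := fun A => by
    refine ⟨g.toLinearEquiv.toLinearMap ∘ₗ (WithLp.linearEquiv 2 ℝ (Fin 4 → ℝ)).symm.toLinearMap ∘ₗ
      A ∘ₗ (WithLp.linearEquiv 2 ℝ (Fin 4 → ℝ)).toLinearMap ∘ₗ g.symm.toLinearEquiv.toLinearMap,
      fun v => ?_⟩
    rw [← hgs]
    simp
  rcases exists_linear_of_circle_conditions (hT 2) (fun i => (hT 3 i).mono (by norm_num))
    (hT 4) (fun x => by
      simp only [T]
      rw [WithLp.toLp_smul, map_smul, taylorTerm_smul, map_smul]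
      norm_num)
    (fun x i => sub_eq_zero.1 ((hcond x).1 i)) (fun x i => sub_eq_zero.1 ((hcond x).2 i))
    with ⟨A, hA'⟩ | ⟨A, hA'⟩
  · obtain ⟨B, hB⟩ := hA A
    refine Or.inl ⟨B, fun v => ?_⟩
    rw [leftTerm, hB, ← hgs v, ← hA', hT2, φ.apply_symm_apply]
  · obtain ⟨B, hB⟩ := hA A
    refine Or.inr ⟨B, fun v => ?_⟩
    change φ (star (star (φ.symm (B v)) * star (φ.symm v))) = _
    rw [star_mul, star_star, star_star, hB, ← hgs v, ← hA', hT2, φ.apply_symm_apply]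

/-- If the second order terms of the circles of a bundle are those of a left transformation, then
the transformation takes the tangent lines to the circles. -/
theorem takesTo_of_normalised {S : Set (Set E4)} (hS : ∀ c ∈ S, IsCircle c ∧ (0 : E4) ∈ c)
    (φ : ℍ[ℝ] ≃ₗᵢ[ℝ] E4) (A : E4 →ₗ[ℝ] E4) {q : E4 → E4} (hA : ∀ v, leftTerm φ A v = q v)
    (hq : ∀ c ∈ S, ∀ v n : E4, v ≠ 0 → ⟪n, v⟫ = 0 → c = circleThrough v n →
      ‖v‖ ^ 2 • n = ‖v‖ ^ 2 • q v - ⟪q v, v⟫ • v) :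
    ∀ c ∈ S, TakesTo (leftTransformation φ A) (tangentLine c) c := by
  intro c hc
  obtain ⟨v, n, hv, hn, hcv⟩ := (hS c hc).1.exists_eq_circleThrough (hS c hc).2
  have h := hq c hc v n hv hn hcv
  rw [hcv, tangentLine_circleThrough hv hn]
  exact takesTo_leftTransformation φ A hv (by rw [hA, h])

/-- The first part of the classification, for any isometric identification with the quaternions.
The bound eight on the degrees in the general position is the degree of the fourth order circle
condition. -/
theorem exists_polynomial_takesTo :
    ∃ (N : ℕ) (P : MvPolynomial (Fin N × Fin 4) ℝ), P ≠ 0 ∧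
      ∀ S : Set (Set E4), IsSimpleBundle S → IsRectifiable S → ContainsGeneric S P →
        ∀ φ : ℍ[ℝ] ≃ₗᵢ[ℝ] E4, ∃ A : E4 →ₗ[ℝ] E4,
          (∀ c ∈ S, TakesTo (leftTransformation φ A) (tangentLine c) c) ∨
            ∀ c ∈ S, TakesTo (rightTransformation φ A) (tangentLine c) c := by
  obtain ⟨N, P, hP, hgen⟩ := exists_generalPosition_polynomial 4 8
  refine ⟨N, P, hP, ?_⟩
  rintro S ⟨hS, -⟩ hrect ⟨c, w, hcw, hPw⟩ φ
  obtain ⟨Ψ, s, hs, hconv, h0, hΨ, hΨ0, hΨ1, hΨc⟩ :=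
    hrect.exists_normalised fun c hc => (hS c hc).2
  have hcond : ∀ c ∈ S, ∀ v n : E4, v ≠ 0 → ⟪n, v⟫ = 0 → c = circleThrough v n →
      ‖v‖ ^ 2 • n = ‖v‖ ^ 2 • taylorTerm Ψ s 2 v - ⟪taylorTerm Ψ s 2 v, v⟫ • v ∧
      CircleConditions v (taylorTerm Ψ s 2 v) (taylorTerm Ψ s 3 v) (taylorTerm Ψ s 4 v) := by
    rintro _ hc v n hv hn rfl
    exact circleConditions_taylorTerm hs hconv h0 hΨ hΨ0 hΨ1
      (hΨc _ hc v (tangentLine_circleThrough hv hn))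
  have hall : ∀ v, CircleConditions v (taylorTerm Ψ s 2 v) (taylorTerm Ψ s 3 v)
      (taylorTerm Ψ s 4 v) := by
    intro v
    have hpoly := fun k i => isPolyFun_taylorTerm Ψ s k (LinearIsometryEquiv.refl ℝ E4) i
    refine circleConditions_of_generalPosition (v := fun i => (w i).ofLp) (hgen _ hPw)
      (hpoly 2) (hpoly 3) (hpoly 4) (fun j => ?_) v.ofLp
    obtain ⟨hj, hjt, hj0⟩ := hcw j
    obtain ⟨n, hn, hcn⟩ :=
      (hS _ hj).1.exists_eq_circleThrough_of_mem_tangentLine (hS _ hj).2 hjt hj0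
    exact (hcond _ hj (w j) n hj0 hn hcn).2
  rcases exists_leftTerm_eq φ hall with ⟨A, hA⟩ | ⟨A, hA⟩
  · exact ⟨A, Or.inl (takesTo_of_normalised hS φ A hA fun c hc v n hv hn hcv =>
      (hcond c hc v n hv hn hcv).1)⟩
  · refine ⟨A, Or.inr ?_⟩
    rw [← leftTransformation_quatConj_trans]
    exact takesTo_of_normalised hS _ A hA fun c hc v n hv hn hcv =>
      (hcond c hc v n hv hn hcv).1

/-! ### Isometries of the quaternions and independence of the quaternionic structure -/

theorem Quaternion.star_eq_neg_of_re_eq_zero {u : ℍ[ℝ]} (h : u.re = 0) : star u = -u := by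
  have := Quaternion.self_add_star' u
  rw [h, mul_zero, Quaternion.coe_zero] at this
  exact eq_neg_of_add_eq_zero_right this

theorem Quaternion.mul_self_eq_neg_one {u : ℍ[ℝ]} (h : u.re = 0) (hu : ‖u‖ = 1) :
    u * u = -1 := by
  have := Quaternion.self_mul_star u
  rw [Quaternion.star_eq_neg_of_re_eq_zero h, Quaternion.normSq_eq_norm_mul_self, hu, mul_one,
    Quaternion.coe_one, mul_neg] at this
  exact neg_eq_iff_eq_neg.1 this

theorem Quaternion.mul_eq_neg_mul_of_inner_eq_zero {u w : ℍ[ℝ]} (hu : u.re = 0) (hw : w.re = 0)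
    (h : ⟪u, w⟫ = 0) : u * w = -(w * u) := by
  have := Quaternion.self_add_star' (u * star w)
  rw [← Quaternion.inner_def, h, mul_zero, Quaternion.coe_zero, star_mul, star_star,
    Quaternion.star_eq_neg_of_re_eq_zero hu, Quaternion.star_eq_neg_of_re_eq_zero hw, mul_neg,
    mul_neg, ← neg_add, neg_eq_zero] at this
  exact eq_neg_of_add_eq_zero_left this

/-- An orthonormal frame of imaginary quaternions is positively or negatively oriented. -/
theorem Quaternion.eq_mul_or_eq_mul_of_orthonormal {u w z : ℍ[ℝ]} (hu : u.re = 0)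
    (hw : w.re = 0) (hz : z.re = 0) (nu : ‖u‖ = 1) (nw : ‖w‖ = 1) (nz : ‖z‖ = 1)
    (huw : ⟪u, w⟫ = 0) (huz : ⟪u, z⟫ = 0) (hwz : ⟪w, z⟫ = 0) : z = u * w ∨ z = w * u := by
  have e1 := Quaternion.mul_self_eq_neg_one hu nu
  have e2 := Quaternion.mul_self_eq_neg_one hw nw
  have e3 := Quaternion.mul_self_eq_neg_one hz nz
  have e4 := Quaternion.mul_eq_neg_mul_of_inner_eq_zero hu hw huw
  have e5 := Quaternion.mul_eq_neg_mul_of_inner_eq_zero hu hz huz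
  have e6 := Quaternion.mul_eq_neg_mul_of_inner_eq_zero hw hz hwz
  have h : (z - u * w) * (z - w * u) = 0 := by
    have h1 : u * w * (w * u) = 1 := by
      rw [mul_assoc, ← mul_assoc w, e2, neg_one_mul, mul_neg, e1, neg_neg]
    have h2 : u * w * z = z * (u * w) := by
      rw [mul_assoc, e6, mul_neg, ← mul_assoc, e5, neg_mul, neg_neg, mul_assoc]
    have h3 : z * (w * u) = -(z * (u * w)) := by rw [e4, mul_neg, neg_neg]
    rw [sub_mul, mul_sub, mul_sub, e3, h1, h2, h3]
    abel
  rcases mul_eq_zero.1 h with h | h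
  · exact Or.inl (sub_eq_zero.1 h)
  · exact Or.inr (sub_eq_zero.1 h)

/-- A linear map of the quaternions that preserves the relations of the units is an
automorphism. -/
theorem exists_algEquiv_of_oriented (h : ℍ[ℝ] →ₗ[ℝ] ℍ[ℝ]) (h1 : h 1 = 1)
    (hi : h (quatOf ![0, 1, 0, 0]) * h (quatOf ![0, 1, 0, 0]) = -1)
    (hj : h (quatOf ![0, 0, 1, 0]) * h (quatOf ![0, 0, 1, 0]) = -1)
    (hij : h (quatOf ![0, 1, 0, 0]) * h (quatOf ![0, 0, 1, 0])
      = -(h (quatOf ![0, 0, 1, 0]) * h (quatOf ![0, 1, 0, 0])))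
    (hk : h (quatOf ![0, 0, 0, 1]) = h (quatOf ![0, 1, 0, 0]) * h (quatOf ![0, 0, 1, 0])) :
    ∃ σ : ℍ[ℝ] ≃ₐ[ℝ] ℍ[ℝ], ∀ x, h x = σ x := by
  let B : QuaternionAlgebra.Basis ℍ[ℝ] (-1 : ℝ) 0 (-1) :=
    { i := h (quatOf ![0, 1, 0, 0])
      j := h (quatOf ![0, 0, 1, 0])
      k := h (quatOf ![0, 0, 0, 1])
      i_mul_i := by rw [hi]; simp
      j_mul_j := by rw [hj]; simp
      i_mul_j := hk.symm
      j_mul_i := by rw [hk, zero_smul, zero_sub, hij, neg_neg] }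
  let σ : ℍ[ℝ] →ₐ[ℝ] ℍ[ℝ] := B.liftHom
  have hσ : ∀ x, h x = σ x := by
    intro x
    have hx : x = x.re • (1 : ℍ[ℝ]) + x.imI • quatOf ![0, 1, 0, 0] + x.imJ • quatOf ![0, 0, 1, 0]
        + x.imK • quatOf ![0, 0, 0, 1] := by
      ext <;> simp
    conv_lhs => rw [hx]
    simp only [map_add, map_smul, h1]
    rw [← Algebra.algebraMap_eq_smul_one]
    rfl
  have hinj : Function.Injective σ := σ.toRingHom.injective
  have hbij : Function.Bijective σ :=
    ⟨hinj, (LinearMap.injective_iff_surjective (f := σ.toLinearMap)).1 hinj⟩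
  exact ⟨AlgEquiv.ofBijective σ hbij, hσ⟩

/-- Orthogonal transformations of the quaternions are compositions of a left multiplication with
an automorphism or an antiautomorphism. -/
theorem exists_algEquiv_of_isometry (g : ℍ[ℝ] ≃ₗᵢ[ℝ] ℍ[ℝ]) :
    ∃ (p : ℍ[ℝ]) (σ : ℍ[ℝ] ≃ₐ[ℝ] ℍ[ℝ]), p ≠ 0 ∧
      ((∀ x, g x = p * σ x) ∨ ∀ x, g (star x) = p * σ x) := by
  have hp : g 1 ≠ 0 := by simp
  have np : ‖g 1‖ = 1 := by rw [g.norm_map, norm_one]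
  let h : ℍ[ℝ] →ₗ[ℝ] ℍ[ℝ] := LinearMap.mulLeft ℝ (g 1)⁻¹ ∘ₗ g.toLinearEquiv.toLinearMap
  have hh : ∀ x, h x = (g 1)⁻¹ * g x := fun x => rfl
  have hgh : ∀ x, g x = g 1 * h x := fun x => by rw [hh, mul_inv_cancel_left₀ hp]
  have h1 : h 1 = 1 := inv_mul_cancel₀ hp
  have hn : ∀ x, ‖h x‖ = ‖x‖ := fun x => by
    rw [hh, norm_mul, norm_inv, np, inv_one, one_mul, g.norm_map]
  let H : ℍ[ℝ] →ₗᵢ[ℝ] ℍ[ℝ] := ⟨h, hn⟩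
  have hin : ∀ x y, (⟪h x, h y⟫ : ℝ) = ⟪x, y⟫ := H.inner_map_map
  have hre : ∀ x : ℍ[ℝ], (h x).re = x.re := fun x => by
    have := hin x 1
    rw [h1, Quaternion.inner_def, Quaternion.inner_def, star_one, mul_one, mul_one] at this
    exact this
  have ni : ‖(quatOf ![0, 1, 0, 0] : ℍ[ℝ])‖ = 1 := by
    rw [← sq_eq_sq₀ (norm_nonneg _) zero_le_one, sq, ← Quaternion.normSq_eq_norm_mul_self,
      Quaternion.normSq_def']
    simp
  have nj : ‖(quatOf ![0, 0, 1, 0] : ℍ[ℝ])‖ = 1 := by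
    rw [← sq_eq_sq₀ (norm_nonneg _) zero_le_one, sq, ← Quaternion.normSq_eq_norm_mul_self,
      Quaternion.normSq_def']
    simp
  have nk : ‖(quatOf ![0, 0, 0, 1] : ℍ[ℝ])‖ = 1 := by
    rw [← sq_eq_sq₀ (norm_nonneg _) zero_le_one, sq, ← Quaternion.normSq_eq_norm_mul_self,
      Quaternion.normSq_def']
    simp
  have ri : (h (quatOf ![0, 1, 0, 0])).re = 0 := by rw [hre]; rfl
  have rj : (h (quatOf ![0, 0, 1, 0])).re = 0 := by rw [hre]; rfl
  have rk : (h (quatOf ![0, 0, 0, 1])).re = 0 := by rw [hre]; rfl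
  have ij : (⟪h (quatOf ![0, 1, 0, 0]), h (quatOf ![0, 0, 1, 0])⟫ : ℝ) = 0 := by
    rw [hin, Quaternion.inner_def]; simp
  have ik : (⟪h (quatOf ![0, 1, 0, 0]), h (quatOf ![0, 0, 0, 1])⟫ : ℝ) = 0 := by
    rw [hin, Quaternion.inner_def]; simp
  have jk : (⟪h (quatOf ![0, 0, 1, 0]), h (quatOf ![0, 0, 0, 1])⟫ : ℝ) = 0 := by
    rw [hin, Quaternion.inner_def]; simp
  have ii := Quaternion.mul_self_eq_neg_one ri ((hn _).trans ni)
  have jj := Quaternion.mul_self_eq_neg_one rj ((hn _).trans nj)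
  have anti := Quaternion.mul_eq_neg_mul_of_inner_eq_zero ri rj ij
  rcases Quaternion.eq_mul_or_eq_mul_of_orthonormal ri rj rk ((hn _).trans ni) ((hn _).trans nj)
    ((hn _).trans nk) ij ik jk with hk | hk
  · obtain ⟨σ, hσ⟩ := exists_algEquiv_of_oriented h h1 ii jj anti hk
    exact ⟨g 1, σ, hp, Or.inl fun x => by rw [hgh, hσ]⟩
  -- a negatively oriented frame becomes positively oriented after conjugation
  · have si : star (quatOf ![0, 1, 0, 0] : ℍ[ℝ]) = -quatOf ![0, 1, 0, 0] :=
      Quaternion.star_eq_neg_of_re_eq_zero rfl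
    have sj : star (quatOf ![0, 0, 1, 0] : ℍ[ℝ]) = -quatOf ![0, 0, 1, 0] :=
      Quaternion.star_eq_neg_of_re_eq_zero rfl
    have sk : star (quatOf ![0, 0, 0, 1] : ℍ[ℝ]) = -quatOf ![0, 0, 0, 1] :=
      Quaternion.star_eq_neg_of_re_eq_zero rfl
    have hs : ∀ x, (h ∘ₗ quatConj.toLinearEquiv.toLinearMap) x = h (star x) := fun x => rfl
    obtain ⟨σ, hσ⟩ := exists_algEquiv_of_oriented (h ∘ₗ quatConj.toLinearEquiv.toLinearMap)
      (by rw [hs, star_one, h1]) (by rw [hs, si, map_neg, neg_mul_neg, ii])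
      (by rw [hs, sj, map_neg, neg_mul_neg, jj])
      (by rw [hs, hs, si, sj, map_neg, map_neg, neg_mul_neg, neg_mul_neg, anti])
      (by rw [hs, hs, hs, si, sj, sk, map_neg, map_neg, map_neg, neg_mul_neg, hk, anti])
    exact ⟨g 1, σ, hp, Or.inr fun x => by rw [hgh, ← hs, hσ]⟩

/-- The transformation `L_A` for `φ'` is `L_B` for `φ`, where `B(x) = A(x) p⁻¹`. -/
theorem range_leftTransformation_eq {φ φ' : ℍ[ℝ] ≃ₗᵢ[ℝ] E4} {p : ℍ[ℝ]} {σ : ℍ[ℝ] ≃ₐ[ℝ] ℍ[ℝ]}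
    (hp : p ≠ 0) (h : ∀ x, φ' x = φ (p * σ x)) :
    Set.range (leftTransformation φ') = Set.range (leftTransformation φ) := by
  let R : ℍ[ℝ] → (E4 →ₗ[ℝ] E4) → (E4 →ₗ[ℝ] E4) := fun q A => φ.toLinearEquiv.toLinearMap ∘ₗ
    LinearMap.mulRight ℝ q ∘ₗ φ.symm.toLinearEquiv.toLinearMap ∘ₗ A
  have hR : ∀ q A x, φ.symm (R q A x) = φ.symm (A x) * q := fun q A x => by simp [R]
  have hsurj : Function.Surjective (R p⁻¹) := fun A => ⟨R p A, LinearMap.ext fun x => by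
    rw [← φ.symm.injective.eq_iff, hR, hR, mul_inv_cancel_right₀ hp]⟩
  have hs : ∀ y, σ (φ'.symm y) = p⁻¹ * φ.symm y := fun y => by
    have := congrArg φ.symm (h (φ'.symm y))
    rw [φ'.apply_symm_apply, φ.symm_apply_apply] at this
    rw [this, inv_mul_cancel_left₀ hp]
  have hL : leftTransformation φ' = leftTransformation φ ∘ R p⁻¹ := by
    funext A x
    refine Part.ext' ?_ ?_
    · change φ'.symm (A x) ≠ 1 ↔ φ.symm (R p⁻¹ A x) ≠ 1
      rw [hR, ne_eq, ← σ.injective.eq_iff, hs, map_one, inv_mul_eq_one₀ hp, ne_eq,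
        mul_inv_eq_one₀ hp, eq_comm]
    · intro _ _
      change φ' ((1 - φ'.symm (A x))⁻¹ * φ'.symm x)
        = φ ((1 - φ.symm (R p⁻¹ A x))⁻¹ * φ.symm x)
      rw [h, map_mul σ, map_inv₀, map_sub, map_one, hs, hs, hR]
      congr 1
      have : 1 - φ.symm (A x) * p⁻¹ = p * (1 - p⁻¹ * φ.symm (A x)) * p⁻¹ := by
        rw [mul_sub, mul_one, mul_inv_cancel_left₀ hp, sub_mul, mul_inv_cancel₀ hp]
      rw [this, mul_inv_rev, mul_inv_rev, inv_inv, mul_assoc, mul_assoc]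
  rw [hL, hsurj.range_comp]

/-- The transformation `R_A` for `φ'` is `R_B` for `φ`, where `B(x) = p⁻¹ A(x)`. -/
theorem range_rightTransformation_eq {φ φ' : ℍ[ℝ] ≃ₗᵢ[ℝ] E4} {p : ℍ[ℝ]} {σ : ℍ[ℝ] ≃ₐ[ℝ] ℍ[ℝ]}
    (hp : p ≠ 0) (h : ∀ x, φ' x = φ (p * σ x)) :
    Set.range (rightTransformation φ') = Set.range (rightTransformation φ) := by
  let R : ℍ[ℝ] → (E4 →ₗ[ℝ] E4) → (E4 →ₗ[ℝ] E4) := fun q A => φ.toLinearEquiv.toLinearMap ∘ₗ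
    LinearMap.mulLeft ℝ q ∘ₗ φ.symm.toLinearEquiv.toLinearMap ∘ₗ A
  have hR : ∀ q A x, φ.symm (R q A x) = q * φ.symm (A x) := fun q A x => by simp [R]
  have hsurj : Function.Surjective (R p⁻¹) := fun A => ⟨R p A, LinearMap.ext fun x => by
    rw [← φ.symm.injective.eq_iff, hR, hR, inv_mul_cancel_left₀ hp]⟩
  have hs : ∀ y, σ (φ'.symm y) = p⁻¹ * φ.symm y := fun y => by
    have := congrArg φ.symm (h (φ'.symm y))
    rw [φ'.apply_symm_apply, φ.symm_apply_apply] at this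
    rw [this, inv_mul_cancel_left₀ hp]
  have hL : rightTransformation φ' = rightTransformation φ ∘ R p⁻¹ := by
    funext A x
    refine Part.ext' ?_ ?_
    · change φ'.symm (A x) ≠ 1 ↔ φ.symm (R p⁻¹ A x) ≠ 1
      rw [hR, ne_eq, ← σ.injective.eq_iff, hs, map_one]
    · intro _ _
      change φ' (φ'.symm x * (1 - φ'.symm (A x))⁻¹)
        = φ (φ.symm x * (1 - φ.symm (R p⁻¹ A x))⁻¹)
      rw [h, map_mul σ, map_inv₀, map_sub, map_one, hs, hs, hR, mul_assoc, mul_inv_cancel_left₀ hp]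
  rw [hL, hsurj.range_comp]

theorem range_transformations (φ φ' : ℍ[ℝ] ≃ₗᵢ[ℝ] E4) :
    (Set.range (leftTransformation φ) = Set.range (leftTransformation φ') ∧
        Set.range (rightTransformation φ) = Set.range (rightTransformation φ')) ∨
      (Set.range (leftTransformation φ) = Set.range (rightTransformation φ') ∧
        Set.range (rightTransformation φ) = Set.range (leftTransformation φ')) := by
  obtain ⟨p, σ, hp, h | h⟩ := exists_algEquiv_of_isometry (φ'.trans φ.symm)
  · have h' : ∀ x, φ' x = φ (p * σ x) := fun x => by
      rw [← h x, LinearIsometryEquiv.trans_apply, φ.apply_symm_apply]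
    exact Or.inl ⟨(range_leftTransformation_eq hp h').symm,
      (range_rightTransformation_eq hp h').symm⟩
  · have h' : ∀ x, (quatConj.trans φ') x = φ (p * σ x) := fun x => by
      rw [← h x]
      exact (φ.apply_symm_apply _).symm
    have hl := range_leftTransformation_eq hp h'
    have hr := range_rightTransformation_eq hp h'
    rw [funext (leftTransformation_quatConj_trans φ')] at hl
    rw [funext (rightTransformation_quatConj_trans φ')] at hr
    exact Or.inr ⟨hl.symm, hr.symm⟩

theorem mainTheorem2 :
    (∃ (N : ℕ) (P : MvPolynomial (Fin N × Fin 4) ℝ), P ≠ 0 ∧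
      ∀ S : Set (Set E4), IsSimpleBundle S → IsRectifiable S → ContainsGeneric S P →
        ∀ (Q : QuaternionicStructure) (e : E4) (he : ‖e‖ = 1),
          ∃ A : E4 →ₗ[ℝ] E4,
            (∀ c ∈ S, TakesTo (leftTransformation (Q.ident e he) A) (tangentLine c) c) ∨
            (∀ c ∈ S, TakesTo (rightTransformation (Q.ident e he) A) (tangentLine c) c)) ∧
    (∀ (Q Q' : QuaternionicStructure) (e e' : E4) (he : ‖e‖ = 1) (he' : ‖e'‖ = 1),
      (Set.range (leftTransformation (Q.ident e he)) =
          Set.range (leftTransformation (Q'.ident e' he')) ∧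
        Set.range (rightTransformation (Q.ident e he)) =
          Set.range (rightTransformation (Q'.ident e' he'))) ∨
      (Set.range (leftTransformation (Q.ident e he)) =
          Set.range (rightTransformation (Q'.ident e' he')) ∧
        Set.range (rightTransformation (Q.ident e he)) =
          Set.range (leftTransformation (Q'.ident e' he')))) := by
  refine ⟨?_, fun Q Q' e e' he he' => range_transformations _ _⟩
  obtain ⟨N, P, hP, h⟩ := exists_polynomial_takesTo
  exact ⟨N, P, hP, fun S hS hrect hgen Q e he => h S hS hrect hgen (Q.ident e he)⟩
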